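/- Let $k\ge 0$ and let $n_1,\dots,n_k\ge 1$ be integers, and put $N=n_1\cdots n_k$. For $M\in GL_m(\mathbb C)$ let $\mathrm{Ad}_M\in\mathrm{Inn}(GL_m(\mathbb C))$ be the inner automorphism $X\mapsto MXM^{-1}$. For $n\ge 1$ put $\omega_n=e^{2\pi \mathrm{i}/n}$, $Q_n=\mathrm{diag}(1,\omega_n,\dots,\omega_n^{n-1})$ and $(P_n)_{a,b}=\delta_{a,b-1}$ for $a,b\in\mathbb Z_n$; let $\Pi_n$ be the subgroup of $GL_n(\mathbb C)$ generated by $Q_n$ and $P_n$, and let $\mathcal P_n=\langle \mathrm{Ad}_{Q_n},\mathrm{Ad}_{P_n}\rangle\subseteq \mathrm{Inn}(GL_n(\mathbb C))$. Put $$\mathcal P_{(n_1,\dots,n_k)}=\{\mathrm{Ad}_{M_1\otimes\cdots\otimes M_k}\mid M_i\in\Pi_{n_i}\}\subseteq \mathrm{Inn}(GL_N(\mathbb C)).$$ Write $\mathcal N(\mathcal P_n)$ and $\mathcal N(\mathcal P_{(n_1,\dots,n_k)})$ for the normalizers of $\mathcal P_n$ in $\mathrm{Inn}(GL_n(\mathbb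 C))$ and of $\mathcal P_{(n_1,\dots,n_k)}$ in $\mathrm{Inn}(GL_N(\mathbb C))$, and put $$\mathcal N(\mathcal P_{n_1})\times\cdots\times\mathcal N(\mathcal P_{n_k})=\{\mathrm{Ad}_{M_1\otimes\cdots\otimes M_k}\mid M_i\in GL_{n_i}(\mathbb C),\ \mathrm{Ad}_{M_i}\in\mathcal N(\mathcal P_{n_i})\ \text{for all } i\}.$$ For $1\le i<j\le k$ let $T_{ij}=I_{n_{i+1}\cdots n_{j-1}}\otimes Q_{n_j}^{n_j/\gcd(n_i,n_j)}$ and $$R_{ij}=I_{n_1\cdots n_{i-1}}\otimes \mathrm{diag}(I_{n_{i+1}\cdots n_j},T_{ij},T_{ij}^2,\dots,T_{ij}^{n_i-1})\otimes I_{n_{j+1}\cdots n_k}.$$ Let $\mathcal S$ be the ring of $k\times k$ matrices $H$ of $2\times 2$ integer blocks of the form $H_{ij}=\frac{n_i}{\gcd(n_i,n_j)}A_{ij}$ with $A_{ij}\in M_2(\mathbb Z)$, and let $H^*\in\mathcal S$ have blocks $(H^*)_{ij}=\frac{n_i}{\gcd(n_i,n_j)}A_{ji}^T$. Let $\ell=\mathrm{lcm}(n_1,\dots,n_k)$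 and $D=\mathrm{diag}(\frac{\ell}{n_1}I_2,\dots,\frac{\ell}{n_k}I_2)$. The relation $H\equiv G\Leftrightarrow DH\equiv DG \pmod \ell$ (entrywise) is a ring congruence on $\mathcal S$ compatible with $*$; let $\mathcal M_{[n_1,\dots,n_k]}=\mathcal S/{\equiv}$ be the quotient ring with the induced $*$ (equivalently, the block matrices with blocks $\frac{n_i}{\gcd(n_i,n_j)}A_{ij}$, $A_{ij}\in M_2(\mathbb Z_{n_i})$). Let $J=\mathrm{diag}(J_2,\dots,J_2)$ with $J_2=\begin{pmatrix}0&1\\-1&0\end{pmatrix}$, and let $$\mathrm{Sp}_{[n_1,\dots,n_k]}=\{H\in\mathcal M_{[n_1,\dots,n_k]}\mid H^*JH=J\},$$ with matrix multiplication. Then: (i) There is a group isomorphism $\mathcal N(\mathcal P_{(n_1,\dots,n_k)})/\mathcal P_{(n_1,\dots,n_k)}\cong \mathrm{Sp}_{[n_1,\dots,n_k]}$. (ii) The group $\mathcal N(\mathcal P_{(n_1,\dots,n_k)})$ is generated by $\mathcal N(\mathcal P_{n_1})\times\cdots\times\mathcal N(\mathcal P_{n_k})$ together with $\{\mathrm{Ad}_{R_{ij}}\mid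 1\le i<j\le k\}$. -/

import Mathlib

namespace MultipartiteHeisenberg

set_option linter.unusedSectionVars false

section OneFactor

/-- The group `Inn (GL_ι(ℂ))` of inner automorphisms of the group of invertible complex matrices
whose rows and columns are indexed by the finite set `ι`. -/
abbrev InnGL (ι : Type) [Fintype ι] [DecidableEq ι] : Type :=
  (MulAut.conj : GL ι ℂ →* MulAut (GL ι ℂ)).range

/-- `M ↦ Ad_M`, where `Ad_M X = M X M⁻¹`. -/
def Ad {ι : Type} [Fintype ι] [DecidableEq ι] : GL ι ℂ →* InnGL ι :=
  (MulAut.conj : GL ι ℂ →* MulAut (GL ι ℂ)).rangeRestrict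

/-- The invertible diagonal matrix with diagonal entries `c x`. -/
def diagGL {ι : Type} [Fintype ι] [DecidableEq ι] (c : ι → ℂˣ) : GL ι ℂ where
  val := Matrix.diagonal fun x => (c x : ℂ)
  inv := Matrix.diagonal fun x => ((c x)⁻¹ : ℂˣ)
  val_inv := by simp [Matrix.diagonal_mul_diagonal]
  inv_val := by simp [Matrix.diagonal_mul_diagonal]

/-- `ω_n = exp (2 π i / n)`. -/
noncomputable def omega (n : ℕ) : ℂˣ :=
  Units.mk0 (Complex.exp (2 * Real.pi * Complex.I / n)) (Complex.exp_ne_zero _)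

variable (n : ℕ) [NeZero n]

/-- The generalized Pauli matrix `Q_n = diag (1, ω_n, …, ω_n ^ (n - 1))`, indexed by `ℤ/n`. -/
noncomputable def pauliQ : GL (ZMod n) ℂ :=
  diagGL fun a => omega n ^ a.val

/-- The generalized Pauli matrix `P_n`, with entries `(P_n)_{a,b} = δ_{a,b-1}` for `a, b ∈ ℤ/n`. -/
def pauliP : GL (ZMod n) ℂ where
  val := Matrix.of fun a b => if a = b - 1 then 1 else 0
  inv := Matrix.of fun a b => if b = a - 1 then 1 else 0
  val_inv := by
    ext a b
    simp [Matrix.mul_apply, Matrix.one_apply, ← sub_eq_iff_eq_add, eq_sub_iff_add_eq]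
  inv_val := by
    ext a b
    simp [Matrix.mul_apply, Matrix.one_apply, eq_comm]

/-- The finite Heisenberg group `Π_n`, generated by `Q_n` and `P_n`. -/
def heisenberg : Subgroup (GL (ZMod n) ℂ) :=
  Subgroup.closure {pauliQ n, pauliP n}

/-- The group `𝒫_n` generated by `Ad_{Q_n}` and `Ad_{P_n}`. -/
def pauliAd : Subgroup (InnGL (ZMod n)) :=
  Subgroup.closure {Ad (pauliQ n), Ad (pauliP n)}

end OneFactor

section Tensor

variable {k : ℕ} (n : Fin k → ℕ) [∀ i, NeZero (n i)]

/-- The configuration space `ℤ/n_1 × ⋯ × ℤ/n_k`, which has `N = n_1 ⋯ n_k` elements and serves as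
the index set of `N × N` matrices. -/
abbrev Config : Type := ∀ i, ZMod (n i)

variable {n} in
/-- The Kronecker product `M_1 ⊗ ⋯ ⊗ M_k`. -/
def kron (M : ∀ i, Matrix (ZMod (n i)) (ZMod (n i)) ℂ) : Matrix (Config n) (Config n) ℂ :=
  Matrix.of fun x y => ∏ i, M i (x i) (y i)

theorem kron_mul (M M' : ∀ i, Matrix (ZMod (n i)) (ZMod (n i)) ℂ) :
    kron M * kron M' = kron (fun i => M i * M' i) := by
  ext x y
  simp only [kron, Matrix.mul_apply, Matrix.of_apply, ← Finset.prod_mul_distrib]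
  rw [Finset.prod_univ_sum, Fintype.piFinset_univ]

theorem kron_one : kron (fun i => (1 : Matrix (ZMod (n i)) (ZMod (n i)) ℂ)) = 1 := by
  ext x y
  simp only [kron, Matrix.of_apply, Matrix.one_apply, Finset.prod_ite_zero, Finset.prod_const_one,
    funext_iff, Finset.mem_univ, true_imp_iff]

/-- The Kronecker product of invertible matrices. -/
def tensor : (∀ i, GL (ZMod (n i)) ℂ) →* GL (Config n) ℂ where
  toFun M :=
    { val := kron fun i => (M i : Matrix (ZMod (n i)) (ZMod (n i)) ℂ)
      inv := kron fun i => ((M i)⁻¹ : GL (ZMod (n i)) ℂ)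
      val_inv := by rw [kron_mul]; simp [kron_one]
      inv_val := by rw [kron_mul]; simp [kron_one] }
  map_one' := Units.ext (kron_one n)
  map_mul' M M' := Units.ext (kron_mul n (fun i => (M i).val) (fun i => (M' i).val)).symm

/-- The group `𝒫_{(n_1, …, n_k)} = {Ad_{M_1 ⊗ ⋯ ⊗ M_k} | M_i ∈ Π_{n_i}}`. -/
def pauliAdTensor : Subgroup (InnGL (Config n)) :=
  ((Subgroup.pi Set.univ fun i => heisenberg (n i)).map (tensor n)).map Ad

/-- The set `𝒩(𝒫_{n_1}) × ⋯ × 𝒩(𝒫_{n_k})` of all `Ad_{M_1 ⊗ ⋯ ⊗ M_k}` such that each `Ad_{M_i}`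
normalizes `𝒫_{n_i}` in `Inn (GL_{n_i}(ℂ))`. -/
def localNormalizer : Set (InnGL (Config n)) :=
  {φ | ∃ M : ∀ i, GL (ZMod (n i)) ℂ,
    (∀ i, Ad (M i) ∈ Subgroup.normalizer (pauliAd (n i) : Set (InnGL (ZMod (n i))))) ∧
    φ = Ad (tensor n M)}

/-- The matrix `R_{ij}`. It is block diagonal along the `i`-th tensor factor; the block at position
`a ∈ {0, …, n_i - 1}` is the `a`-th power of `Q_{n_j} ^ (n_j / gcd (n_i, n_j))` acting on the `j`-th
factor. Hence it is diagonal. -/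
noncomputable def R (i j : Fin k) : GL (Config n) ℂ :=
  diagGL fun x => ((omega (n j) ^ (x j).val) ^ (n j / Nat.gcd (n i) (n j))) ^ (x i).val

end Tensor

section Symplectic

variable {k : ℕ} (n : Fin k → ℕ)

/-- `k × k` matrices of `2 × 2` blocks over `ℤ`. -/
abbrev BlockMatrix (k : ℕ) : Type := Matrix (Fin k) (Fin k) (Matrix (Fin 2) (Fin 2) ℤ)

/-- The factor `n_i / gcd (n_i, n_j)`. -/
def ratio (i j : Fin k) : ℤ := ((n i / Nat.gcd (n i) (n j) : ℕ) : ℤ)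

theorem ratio_mul_gcd (i j : Fin k) : ratio n i j * (Nat.gcd (n i) (n j) : ℤ) = n i := by
  rw [ratio, ← Nat.cast_mul, Nat.div_mul_cancel (Nat.gcd_dvd_left _ _)]

theorem mul_ratio_comm (i j : Fin k) : (n j : ℤ) * ratio n i j = n i * ratio n j i := by
  have h1 := ratio_mul_gcd n i j
  have h2 := ratio_mul_gcd n j i
  rw [Nat.gcd_comm] at h2
  linear_combination (-ratio n i j) * h2 + ratio n j i * h1

theorem dvd_mul_ratio (i j : Fin k) : (n i : ℤ) ∣ n j * ratio n i j :=
  ⟨ratio n j i, mul_ratio_comm n i j⟩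

theorem ratio_self (i : Fin k) [NeZero (n i)] : ratio n i i = 1 := by
  simp [ratio, Nat.div_self (NeZero.pos (n i))]

variable [∀ i, NeZero (n i)]

theorem ratio_dvd_iff (i j : Fin k) (x : ℤ) : ratio n i j ∣ x ↔ (n i : ℤ) ∣ n j * x := by
  constructor
  · rintro ⟨y, rfl⟩
    exact ⟨ratio n j i * y, by rw [← mul_assoc, mul_ratio_comm, mul_assoc]⟩
  · intro h
    have hg : 0 < Nat.gcd (n i) (n j) := Nat.gcd_pos_of_pos_left _ (NeZero.pos (n i))
    have h1 := ratio_mul_gcd n i j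
    have h2 := ratio_mul_gcd n j i
    rw [Nat.gcd_comm] at h2
    rw [← h1, ← h2, mul_right_comm] at h
    have h3 := Int.dvd_of_mul_dvd_mul_right (by exact_mod_cast hg.ne') h
    refine IsCoprime.dvd_of_dvd_mul_left ?_ h3
    rw [ratio, ratio, Nat.isCoprime_iff_coprime, Nat.gcd_comm (n j)]
    exact Nat.coprime_div_gcd_div_gcd hg

theorem exists_blocks_iff (H : BlockMatrix k) :
    (∃ A : BlockMatrix k, ∀ i j, H i j = ratio n i j • A i j) ↔
      ∀ i j a b, (n i : ℤ) ∣ n j * H i j a b := by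
  constructor
  · rintro ⟨A, hA⟩ i j a b
    rw [← ratio_dvd_iff, hA i j]
    exact ⟨A i j a b, by simp⟩
  · intro h
    choose A hA using fun i j a b => (ratio_dvd_iff n i j _).2 (h i j a b)
    refine ⟨fun i j => Matrix.of fun a b => A i j a b, fun i j => ?_⟩
    ext a b
    simpa using hA i j a b

theorem block_mul_apply (H G : BlockMatrix k) (i j : Fin k) (a b : Fin 2) :
    (H * G) i j a b = ∑ m, ∑ c, H i m a c * G m j c b := by
  simp [Matrix.mul_apply, Matrix.sum_apply]

/-- The ring `𝒮_{[n_1, …, n_k]}` of integral block matrices `H` with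
`H_{ij} = (n_i / gcd (n_i, n_j)) A_{ij}`. -/
def S : Subring (BlockMatrix k) where
  carrier := {H | ∃ A : BlockMatrix k, ∀ i j, H i j = ratio n i j • A i j}
  mul_mem' {H G} hH hG := by
    simp only [Set.mem_ofPred_eq, exists_blocks_iff] at hH hG ⊢
    intro i j a b
    rw [block_mul_apply, Finset.mul_sum]
    refine Finset.dvd_sum fun m _ => ?_
    rw [Finset.mul_sum]
    refine Finset.dvd_sum fun c _ => ?_
    obtain ⟨t, ht⟩ := hG m j c b
    rw [mul_left_comm, ht, ← mul_assoc, mul_comm (H i m a c)]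
    exact (hH i m a c).mul_right t
  one_mem' := ⟨1, fun i j => by
    by_cases h : i = j
    · subst h; simp [ratio_self]
    · simp [Matrix.one_apply_ne h]⟩
  add_mem' {H G} := by
    rintro ⟨A, hA⟩ ⟨B, hB⟩
    exact ⟨A + B, fun i j => by simp [hA, hB]⟩
  zero_mem' := ⟨0, fun i j => by simp⟩
  neg_mem' {H} := by
    rintro ⟨A, hA⟩
    exact ⟨-A, fun i j => by simp [hA]⟩

theorem mem_S_iff (H : BlockMatrix k) :
    H ∈ S n ↔ ∀ i j a b, (n i : ℤ) ∣ n j * H i j a b :=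
  exists_blocks_iff n H

/-- `ℓ = lcm (n_1, …, n_k)`. -/
def ell : ℕ := Finset.univ.lcm n

/-- The block diagonal matrix `D = diag ((ℓ / n_1) I_2, …, (ℓ / n_k) I_2)`. -/
def D : BlockMatrix k :=
  Matrix.diagonal fun i => (((ell n / n i : ℕ) : ℤ) • (1 : Matrix (Fin 2) (Fin 2) ℤ))

/-- The congruence `H ≡ G`, that is, `D H ≡ D G` modulo `ℓ` entrywise. -/
def Congr (H G : BlockMatrix k) : Prop :=
  ∀ i j a b, (D n * H) i j a b ≡ (D n * G) i j a b [ZMOD (ell n : ℤ)]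

theorem congr_iff (H G : BlockMatrix k) :
    Congr n H G ↔ ∀ i j a b, (n i : ℤ) ∣ G i j a b - H i j a b := by
  have hl : ell n ≠ 0 := by
    simp [ell, Finset.lcm_eq_zero_iff, NeZero.ne]
  refine forall_congr' fun i => forall_congr' fun j => forall_congr' fun a =>
    forall_congr' fun b => ?_
  have hd : ell n / n i * n i = ell n := Nat.div_mul_cancel (Finset.dvd_lcm (Finset.mem_univ i))
  have hq : ((ell n / n i : ℕ) : ℤ) ≠ 0 := by
    intro h0
    rw [Nat.cast_eq_zero] at h0
    rw [h0, zero_mul] at hd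
    exact hl hd.symm
  have hd' : (ell n : ℤ) = ((ell n / n i : ℕ) : ℤ) * n i := by exact_mod_cast hd.symm
  rw [Int.modEq_iff_dvd, D, Matrix.diagonal_mul, Matrix.diagonal_mul]
  simp only [smul_mul_assoc, one_mul, Matrix.smul_apply, smul_eq_mul]
  rw [← mul_sub, hd', mul_dvd_mul_iff_left hq]

/-- The congruence on the ring `𝒮_{[n_1, …, n_k]}`. -/
def ringCon : RingCon (S n) where
  r H G := Congr n H G
  iseqv :=
    { refl := fun _ _ _ _ _ => Int.ModEq.rfl
      symm := fun h i j a b => (h i j a b).symm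
      trans := fun h h' i j a b => (h i j a b).trans (h' i j a b) }
  add' {H H' G G'} hH hG := by
    rw [congr_iff] at hH hG ⊢
    intro i j a b
    have := dvd_add (hH i j a b) (hG i j a b)
    simpa [add_sub_add_comm] using this
  mul' {H H' G G'} hH hG := by
    rw [congr_iff] at hH hG ⊢
    intro i j a b
    have hS := (mem_S_iff n _).1 H.2
    simp only [Subring.coe_mul, block_mul_apply, ← Finset.sum_sub_distrib]
    refine Finset.dvd_sum fun m _ => Finset.dvd_sum fun c _ => ?_
    have h1 : (n i : ℤ) ∣ (H : BlockMatrix k) i m a c *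
        ((G' : BlockMatrix k) m j c b - (G : BlockMatrix k) m j c b) := by
      obtain ⟨t, ht⟩ := hG m j c b
      rw [ht, ← mul_assoc, mul_comm ((H : BlockMatrix k) i m a c)]
      exact (hS i m a c).mul_right t
    have h2 := ((hH i m a c).mul_right ((G' : BlockMatrix k) m j c b))
    have := dvd_add h1 h2
    convert this using 1
    ring

/-- The ring `ℳ_{[n_1, …, n_k]}`: block matrices with blocks
`H_{ij} = (n_i / gcd (n_i, n_j)) A_{ij}` over `ℤ/n_i`, realized as the quotient of
`𝒮_{[n_1, …, n_k]}` by the congruence. -/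
abbrev M : Type := (ringCon n).Quotient

/-- The block matrix with blocks `(H^*)_{ij} = (n_i / gcd (n_i, n_j)) A_{ji}ᵀ`, where
`H_{ji} = (n_j / gcd (n_j, n_i)) A_{ji}`. -/
def adjointMatrix (H : BlockMatrix k) : BlockMatrix k :=
  fun i j => Matrix.of fun a b => ratio n i j * (H j i b a / ratio n j i)

theorem adjointMatrix_spec {H : BlockMatrix k} (hH : H ∈ S n) (i j : Fin k) (a b : Fin 2) :
    (n j : ℤ) * adjointMatrix n H i j a b = n i * H j i b a := by
  have h := Int.mul_ediv_cancel' ((ratio_dvd_iff n j i _).2 ((mem_S_iff n H).1 hH j i b a))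
  rw [adjointMatrix, Matrix.of_apply, ← mul_assoc, mul_ratio_comm, mul_assoc, h]

theorem adjointMatrix_eq (H A : BlockMatrix k) (hA : ∀ i j, H i j = ratio n i j • A i j)
    (i j : Fin k) : adjointMatrix n H i j = ratio n i j • (A j i).transpose := by
  have h0 : ratio n j i ≠ 0 := by
    intro h0
    have := ratio_mul_gcd n j i
    rw [h0, zero_mul] at this
    exact NeZero.ne (n j) (by exact_mod_cast this.symm)
  ext a b
  simp [adjointMatrix, hA, h0]

/-- The adjoint `H ↦ H^*` on `𝒮_{[n_1, …, n_k]}`. -/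
def adjointS (H : S n) : S n :=
  ⟨adjointMatrix n H, fun i j => Matrix.of fun a b => (H : BlockMatrix k) j i b a / ratio n j i,
    fun i j => by ext a b; simp [adjointMatrix]⟩

theorem eq_adjointS {H X : S n} (h : ∀ i j a b, (n j : ℤ) * (X : BlockMatrix k) i j a b =
    n i * (H : BlockMatrix k) j i b a) : X = adjointS n H := by
  apply Subtype.ext
  ext i j a b
  have hj : (n j : ℤ) ≠ 0 := by exact_mod_cast NeZero.ne (n j)
  exact mul_left_cancel₀ hj ((h i j a b).trans (adjointMatrix_spec n H.2 i j a b).symm)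

theorem adjointS_mul (H G : S n) : adjointS n (H * G) = adjointS n G * adjointS n H := by
  symm
  apply eq_adjointS
  intro i j a b
  simp only [Subring.coe_mul, block_mul_apply, Finset.mul_sum]
  refine Finset.sum_congr rfl fun m _ => Finset.sum_congr rfl fun c _ => ?_
  have h1 := adjointMatrix_spec n G.2 i m a c
  have h2 := adjointMatrix_spec n H.2 m j c b
  change (n j : ℤ) * (adjointMatrix n G i m a c * adjointMatrix n H m j c b) = _
  linear_combination (adjointMatrix n G i m a c) * h2 + ((H : BlockMatrix k) j m b c) * h1

theorem adjointS_one : adjointS n 1 = 1 := by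
  symm
  apply eq_adjointS
  intro i j a b
  by_cases h : i = j
  · subst h
    simp [Matrix.one_apply, eq_comm]
  · simp [Matrix.one_apply_ne h, Matrix.one_apply_ne (Ne.symm h)]

theorem adjointS_congr (H G : S n) (h : ringCon n H G) :
    ringCon n (adjointS n H) (adjointS n G) := by
  change Congr n _ _ at h
  change Congr n _ _
  rw [congr_iff] at h ⊢
  intro i j a b
  obtain ⟨t, ht⟩ := h j i b a
  have h1 := adjointMatrix_spec n H.2 i j a b
  have h2 := adjointMatrix_spec n G.2 i j a b
  have hj : (n j : ℤ) ≠ 0 := by exact_mod_cast NeZero.ne (n j)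
  refine ⟨t, mul_left_cancel₀ hj ?_⟩
  change (n j : ℤ) * (adjointMatrix n G i j a b - adjointMatrix n H i j a b) = _
  linear_combination h2 - h1 + (n i : ℤ) * ht

/-- The adjoint `H ↦ H^*` on `ℳ_{[n_1, …, n_k]}`. -/
def adjoint : M n → M n :=
  Quotient.map (adjointS n) (adjointS_congr n)

/-- The block matrix `J = diag (J_2, …, J_2)` with `J_2 = (0, 1; -1, 0)`. -/
def JS : S n :=
  ⟨Matrix.diagonal fun _ => !![0, 1; -1, 0], Matrix.diagonal fun _ => !![0, 1; -1, 0],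
    fun i j => by
      by_cases h : i = j
      · subst h; simp [ratio_self]
      · simp [Matrix.diagonal_apply_ne _ h]⟩

/-- The class of `J` in `ℳ_{[n_1, …, n_k]}`. -/
def J : M n := (JS n : M n)

/-- `Sp_{[n_1, …, n_k]} = {H ∈ ℳ_{[n_1, …, n_k]} | H^* J H = J}`, with matrix multiplication. -/
def Sp : Submonoid (M n) where
  carrier := {H | adjoint n H * J n * H = J n}
  one_mem' := by
    have : adjoint n 1 = 1 := congrArg (fun H : S n => (H : M n)) (adjointS_one n)
    simp [this]
  mul_mem' {H G} hH hG := by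
    have hm : adjoint n (H * G) = adjoint n G * adjoint n H := by
      induction H using Quotient.inductionOn with | _ H =>
      induction G using Quotient.inductionOn with | _ G =>
      exact congrArg (fun H : S n => (H : M n)) (adjointS_mul n H G)
    simp only [Set.mem_ofPred_eq] at hH hG ⊢
    calc adjoint n (H * G) * J n * (H * G)
        = adjoint n G * (adjoint n H * J n * H) * G := by rw [hm]; simp only [mul_assoc]
      _ = J n := by rw [hH, hG]

end Symplectic

end MultipartiteHeisenberg

/-!
The normalizer of the Pauli group is a projective extension of the symplectic group of the discrete
phase space `V = ∏ i, (ℤ/n_i)²`.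

The Weyl operators `W(v)`, the tensor products of the matrices `Q ^ a P ^ b`, multiply like the
elements of `V` up to scalars and commute up to the alternating `ℂˣ`-valued pairing `form`
(`weyl_comm`). Hence `v ↦ Ad_{W(v)}` identifies `V` with the Pauli group
(`mem_pauliAdTensor_iff`, `pauli_injective`), and an element of the normalizer acts on `V` by an
endomorphism that preserves `form` (`exists_isometry`). It acts trivially only if it lies in the
Pauli group, by the irreducibility of the Weyl operators and the nondegeneracy of `form`
(`mem_pauliAdTensor_of_commute`).

On the other side, the integral block matrices in `𝒮` act on `V`, two of them in the same way
exactly if they are congruent, and every endomorphism of `V` arises (`act_eq_iff`,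
`act_surjective`). Since `H^*` is the adjoint of `H` with respect to the standard symmetric pairing,
and `J` turns that pairing into `form`, the equation `H^* J H = J` says that `H` preserves `form`
(`mem_Sp_iff`). So `Sp` is the monoid of form-preserving endomorphisms.

Both parts of the theorem then follow once every form-preserving endomorphism is induced by
an element of the group generated by the local normalizers and the `Ad_{R_{ij}}`. This group induces
three kinds of elementary isometries: a shear of one factor (conjugation by a diagonal Gaussian),
a quarter turn of one factor (the discrete Fourier transform), and a shear coupling two factors
(conjugation by `R_{ij}⁻¹`). That these generate all isometries is
`IsElementary.isometries_le`, a Gaussian elimination over all `n_i` at once, without passing to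
primary components: the image of a basis vector is moved back to the basis vector by making one
coordinate a unit, which is possible because `ℤ/n` has stable range one, and then clearing the other
coordinates.
-/

namespace MultipartiteHeisenberg

set_option linter.unusedSectionVars false

/-! ### Characters of `ℚ` and of `ℤ/n` -/

/-- The character `q ↦ exp (2 π i q)` of `ℚ`. -/
noncomputable def ratChar : AddChar ℚ ℂˣ where
  toFun q := Units.mk0 (Complex.exp (2 * Real.pi * Complex.I * q)) (Complex.exp_ne_zero _)
  map_zero_eq_one' := by ext; simp
  map_add_eq_mul' p q := by ext; simp [mul_add, Complex.exp_add]

theorem ratChar_eq_one_iff (q : ℚ) : ratChar q = 1 ↔ ∃ m : ℤ, q = m := by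
  rw [Units.ext_iff]
  change Complex.exp (2 * Real.pi * Complex.I * q) = 1 ↔ _
  rw [Complex.exp_eq_one_iff]
  refine exists_congr fun m => ?_
  have h : (2 * Real.pi * Complex.I : ℂ) ≠ 0 := Complex.two_pi_I_ne_zero
  rw [mul_comm, mul_left_inj' h]
  exact_mod_cast Iff.rfl

theorem ratChar_sum {α : Type*} (s : Finset α) (f : α → ℚ) :
    ratChar (∑ x ∈ s, f x) = ∏ x ∈ s, ratChar (f x) :=
  map_prod ratChar.toMonoidHom (fun x => Multiplicative.ofAdd (f x)) s

theorem ratChar_eq_iff (p q : ℚ) : ratChar p = ratChar q ↔ ∃ m : ℤ, p - q = m := by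
  rw [← ratChar_eq_one_iff, AddChar.map_sub_eq_div, div_eq_one]

theorem omega_pow (n m : ℕ) : omega n ^ m = ratChar (m / n : ℚ) := by
  ext
  rw [Units.val_pow_eq_pow_val]
  change Complex.exp _ ^ m = Complex.exp _
  rw [← Complex.exp_nat_mul]
  congr 1
  push_cast
  ring

theorem omega_pow_self (n : ℕ) [NeZero n] : omega n ^ n = 1 := by
  rw [omega_pow, ratChar_eq_one_iff]
  exact ⟨1, by simp [NeZero.ne n]⟩

/-- The character `a ↦ ω_n ^ a` of `ℤ/n`. -/
noncomputable def rootChar (n : ℕ) [NeZero n] : AddChar (ZMod n) ℂˣ :=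
  AddChar.zmodChar n (omega_pow_self n)

theorem rootChar_intCast (n : ℕ) [NeZero n] (m : ℤ) : rootChar n m = ratChar (m / n : ℚ) := by
  have h : rootChar n m = omega n ^ (m : ZMod n).val := rfl
  rw [h, omega_pow, ratChar_eq_iff]
  have hd : (n : ℤ) ∣ ((m : ZMod n).val : ℤ) - m := by
    rw [← ZMod.intCast_eq_intCast_iff_dvd_sub]
    simp
  obtain ⟨t, ht⟩ := hd
  refine ⟨t, ?_⟩
  have hn : (n : ℚ) ≠ 0 := by exact_mod_cast NeZero.ne n
  rw [← sub_div, div_eq_iff hn, mul_comm]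
  exact_mod_cast ht

theorem rootChar_eq_one_iff (n : ℕ) [NeZero n] (a : ZMod n) : rootChar n a = 1 ↔ a = 0 := by
  constructor
  · intro h
    obtain ⟨m, rfl⟩ := ZMod.intCast_surjective a
    rw [rootChar_intCast, ratChar_eq_one_iff] at h
    obtain ⟨t, ht⟩ := h
    have hn : (n : ℚ) ≠ 0 := by exact_mod_cast NeZero.ne n
    rw [div_eq_iff hn] at ht
    rw [ZMod.intCast_zmod_eq_zero_iff_dvd]
    exact ⟨t, by rw [mul_comm]; exact_mod_cast ht⟩
  · rintro rfl
    exact AddChar.map_zero_eq_one _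

theorem rootChar_injective (n : ℕ) [NeZero n] : Function.Injective (rootChar n) := by
  intro a b h
  rw [← sub_eq_zero, ← rootChar_eq_one_iff, AddChar.map_sub_eq_div, div_eq_one, h]

/-! ### The discrete phase space and its pairings -/

section PhaseSpace

variable {k : ℕ} (n : Fin k → ℕ)

/-- The discrete phase space `∏ i, (ℤ/n_i)²`. The coordinates `0` and `1` of the `i`-th component
are the exponents of `Q_{n_i}` and of `P_{n_i}`. -/
abbrev PhaseSpace : Type := ∀ i, Fin 2 → ZMod (n i)

/-- Reduction of integral vectors to the phase space. -/
def red (l : Fin k → Fin 2 → ℤ) : PhaseSpace n := fun i a => (l i a : ZMod (n i))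

variable {n}

theorem red_surjective : Function.Surjective (red n) := fun v =>
  ⟨fun i a => (ZMod.intCast_surjective (v i a)).choose, by
    ext i a; exact (ZMod.intCast_surjective (v i a)).choose_spec⟩

variable [∀ i, NeZero (n i)]

/-- The commutation form of the Weyl operators, an alternating pairing on the phase space. -/
noncomputable def form (u v : PhaseSpace n) : ℂˣ :=
  ∏ i, rootChar (n i) (u i 0 * v i 1 - u i 1 * v i 0)

/-- The standard symmetric pairing on the phase space. -/
noncomputable def dot (u v : PhaseSpace n) : ℂˣ :=
  ∏ i, ∏ a, rootChar (n i) (u i a * v i a)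

theorem form_red (u v : Fin k → Fin 2 → ℤ) : form (red n u) (red n v) =
    ratChar (∑ i, ((u i 0 * v i 1 - u i 1 * v i 0 : ℤ) : ℚ) / n i) := by
  rw [ratChar_sum]
  refine Finset.prod_congr rfl fun i _ => ?_
  rw [← rootChar_intCast]
  simp [red]

theorem dot_red (u v : Fin k → Fin 2 → ℤ) : dot (red n u) (red n v) =
    ratChar (∑ i, ∑ a, ((u i a * v i a : ℤ) : ℚ) / n i) := by
  rw [ratChar_sum]
  refine Finset.prod_congr rfl fun i _ => ?_
  rw [ratChar_sum]
  refine Finset.prod_congr rfl fun a _ => ?_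
  rw [← rootChar_intCast]
  simp [red]

/-- The vector with `x` at coordinate `a` of the `i`-th component, and zeros elsewhere. -/
def inc (i : Fin k) (a : Fin 2) : ZMod (n i) →+ PhaseSpace n :=
  (AddMonoidHom.single (fun i => Fin 2 → ZMod (n i)) i).comp
    (AddMonoidHom.single (fun _ : Fin 2 => ZMod (n i)) a)

theorem inc_same (i : Fin k) (a b : Fin 2) (x : ZMod (n i)) :
    inc i a x i b = if b = a then x else 0 := by
  simp [inc, Pi.single_apply]

theorem inc_ne {i j : Fin k} (h : j ≠ i) (a : Fin 2) (x : ZMod (n i)) :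
    inc i a x j = 0 := by
  simp [inc, Pi.single_eq_of_ne h]

theorem sum_inc (v : PhaseSpace n) : ∑ i, ∑ a, inc i a (v i a) = v := by
  ext j b
  simp only [Finset.sum_apply]
  rw [Finset.sum_eq_single j]
  · simp [inc_same]
  · intro i _ hi
    simp [inc_ne hi.symm]
  · simp

theorem dot_inc (i : Fin k) (a : Fin 2) (x : ZMod (n i)) (v : PhaseSpace n) :
    dot (inc i a x) v = rootChar (n i) (x * v i a) := by
  unfold dot
  rw [Finset.prod_eq_single i]
  · rw [Finset.prod_eq_single a]
    · simp [inc_same]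
    · intro b _ hb
      simp [inc_same, hb]
    · simp
  · intro j _ hj
    simp [inc_ne hj]
  · simp

theorem eq_of_dot_eq {u v : PhaseSpace n} (h : ∀ w, dot w u = dot w v) : u = v := by
  ext i a
  have := h (inc i a 1)
  rw [dot_inc, dot_inc, one_mul, one_mul] at this
  exact rootChar_injective _ this

theorem form_add_left (u u' v : PhaseSpace n) : form (u + u') v = form u v * form u' v := by
  rw [form, form, form, ← Finset.prod_mul_distrib]
  refine Finset.prod_congr rfl fun i _ => ?_
  rw [← AddChar.map_add_eq_mul]
  congr 1
  simp only [Pi.add_apply]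
  ring

theorem form_swap (u v : PhaseSpace n) : form v u = (form u v)⁻¹ := by
  rw [form, form, ← Finset.prod_inv_distrib]
  refine Finset.prod_congr rfl fun i _ => ?_
  rw [← AddChar.map_neg_eq_inv]
  congr 1
  ring

theorem form_inc_zero (i : Fin k) (x : ZMod (n i)) (v : PhaseSpace n) :
    form (inc i 0 x) v = rootChar (n i) (x * v i 1) := by
  unfold form
  rw [Finset.prod_eq_single i]
  · simp [inc_same]
  · intro j _ hj
    simp [inc_ne hj]
  · simp

theorem form_inc_one (i : Fin k) (x : ZMod (n i)) (v : PhaseSpace n) :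
    form (inc i 1 x) v = rootChar (n i) (-(x * v i 0)) := by
  unfold form
  rw [Finset.prod_eq_single i]
  · simp [inc_same]
  · intro j _ hj
    simp [inc_ne hj]
  · simp

theorem eq_of_form_eq {u v : PhaseSpace n} (h : ∀ w, form w u = form w v) : u = v := by
  ext i a
  have h0 := h (inc i 0 1)
  have h1 := h (inc i 1 1)
  rw [form_inc_zero, form_inc_zero, one_mul, one_mul] at h0
  rw [form_inc_one, form_inc_one, one_mul, one_mul] at h1
  fin_cases a
  · exact neg_injective (rootChar_injective _ h1)
  · exact rootChar_injective _ h0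

end PhaseSpace

/-! ### Endomorphisms of the phase space as block matrices -/

section Action

variable {k : ℕ} {n : Fin k → ℕ}

/-- The action of block matrices on integral vectors. -/
def mulLattice (H : BlockMatrix k) (l : Fin k → Fin 2 → ℤ) : Fin k → Fin 2 → ℤ :=
  fun i a => ∑ j, ∑ b, H i j a b * l j b

theorem mulLattice_add (H : BlockMatrix k) (l l' : Fin k → Fin 2 → ℤ) :
    mulLattice H (l + l') = mulLattice H l + mulLattice H l' := by
  ext i a
  simp [mulLattice, mul_add, Finset.sum_add_distrib]

theorem mulLattice_mul (H G : BlockMatrix k) (l : Fin k → Fin 2 → ℤ) :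
    mulLattice (H * G) l = mulLattice H (mulLattice G l) := by
  ext i a
  simp only [mulLattice, block_mul_apply, Finset.mul_sum, Finset.sum_mul]
  have h1 : ∀ j, ∑ b, ∑ m, ∑ c, H i m a c * G m j c b * l j b =
      ∑ m, ∑ c, ∑ b, H i m a c * G m j c b * l j b := fun j => by
    rw [Finset.sum_comm]
    exact Finset.sum_congr rfl fun m _ => Finset.sum_comm
  simp only [h1]
  rw [Finset.sum_comm]
  refine Finset.sum_congr rfl fun m _ => ?_
  rw [Finset.sum_comm]
  simp only [mul_assoc]

theorem mulLattice_one (l : Fin k → Fin 2 → ℤ) : mulLattice 1 l = l := by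
  ext i a
  rw [mulLattice, Finset.sum_eq_single i]
  · simp [Matrix.one_apply]
  · intro j _ hj
    simp [Matrix.one_apply_ne hj.symm]
  · simp

theorem red_add (l l' : Fin k → Fin 2 → ℤ) : red n (l + l') = red n l + red n l' := by
  ext i a
  simp [red]

theorem red_eq_iff (l l' : Fin k → Fin 2 → ℤ) :
    red n l = red n l' ↔ ∀ i a, (n i : ℤ) ∣ l' i a - l i a := by
  simp only [funext_iff, red, ZMod.intCast_eq_intCast_iff_dvd_sub]

/-- The basis vectors of the lattice. -/
def latticeBasis (j : Fin k) (b : Fin 2) : Fin k → Fin 2 → ℤ :=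
  Pi.single j (Pi.single b 1)

theorem mulLattice_basis (H : BlockMatrix k) (i j : Fin k) (a b : Fin 2) :
    mulLattice H (latticeBasis j b) i a = H i j a b := by
  rw [mulLattice, Finset.sum_eq_single j]
  · simp [latticeBasis, Pi.single_apply]
  · intro m _ hm
    simp [latticeBasis, Pi.single_eq_of_ne hm]
  · simp

variable [∀ i, NeZero (n i)]

/-- Matrices in `𝒮` preserve the kernel of the reduction of integral vectors. -/
theorem red_mulLattice_congr {H : BlockMatrix k} (hH : H ∈ S n) {l l' : Fin k → Fin 2 → ℤ}
    (h : red n l = red n l') : red n (mulLattice H l) = red n (mulLattice H l') := by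
  rw [red_eq_iff] at h ⊢
  rw [mem_S_iff] at hH
  intro i a
  simp only [mulLattice, ← Finset.sum_sub_distrib, ← mul_sub]
  refine Finset.dvd_sum fun j _ => Finset.dvd_sum fun b _ => ?_
  obtain ⟨t, ht⟩ := h j b
  rw [ht, ← mul_assoc, mul_comm (H i j a b)]
  exact (hH i j a b).mul_right t

/-- The endomorphism of the phase space given by a matrix in `𝒮`. -/
noncomputable def act (H : S n) : AddMonoid.End (PhaseSpace n) where
  toFun v := red n (mulLattice H (red_surjective v).choose)
  map_zero' := by
    have h : red n (0 : Fin k → Fin 2 → ℤ) = 0 := by ext; simp [red]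
    rw [red_mulLattice_congr H.2 ((red_surjective (0 : PhaseSpace n)).choose_spec.trans h.symm)]
    ext
    simp [red, mulLattice]
  map_add' u v := by
    rw [← red_add, ← mulLattice_add]
    apply red_mulLattice_congr H.2
    rw [red_add, (red_surjective u).choose_spec, (red_surjective v).choose_spec,
      (red_surjective (u + v)).choose_spec]

theorem act_red (H : S n) (l : Fin k → Fin 2 → ℤ) :
    act H (red n l) = red n (mulLattice H l) :=
  red_mulLattice_congr H.2 (red_surjective (red n l)).choose_spec

theorem act_mul (H G : S n) : act (H * G) = act H * act G := by
  refine DFunLike.ext _ _ fun v => ?_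
  obtain ⟨l, rfl⟩ := red_surjective v
  change _ = act H (act G _)
  rw [act_red, act_red, act_red, Subring.coe_mul, mulLattice_mul]

theorem act_one : act (1 : S n) = 1 := by
  refine DFunLike.ext _ _ fun v => ?_
  obtain ⟨l, rfl⟩ := red_surjective v
  rw [act_red, Subring.coe_one, mulLattice_one]
  rfl

theorem act_eq_iff (H G : S n) : act H = act G ↔ ringCon n H G := by
  change _ ↔ Congr n H G
  rw [congr_iff]
  constructor
  · intro h i j a b
    have := congrArg (fun f : AddMonoid.End (PhaseSpace n) => f (red n (latticeBasis j b))) h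
    simp only [act_red, red_eq_iff, mulLattice_basis] at this
    exact this i a
  · intro h
    refine DFunLike.ext _ _ fun v => ?_
    obtain ⟨l, rfl⟩ := red_surjective v
    rw [act_red, act_red, red_eq_iff]
    intro i a
    simp only [mulLattice, ← Finset.sum_sub_distrib, ← sub_mul]
    exact Finset.dvd_sum fun j _ => Finset.dvd_sum fun b _ => (h i j a b).mul_right _

theorem red_latticeBasis (j : Fin k) (b : Fin 2) : red n (latticeBasis j b) = inc j b 1 := by
  ext i a
  by_cases h : i = j
  · subst h
    simp [red, latticeBasis, inc_same, Pi.single_apply]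
  · simp [red, latticeBasis, inc_ne h, Pi.single_eq_of_ne h]

theorem inc_intCast (j : Fin k) (b : Fin 2) (m : ℤ) :
    inc (n := n) j b (m : ZMod (n j)) = m • inc j b 1 := by
  rw [← map_zsmul, zsmul_one]

theorem end_ext {f g : AddMonoid.End (PhaseSpace n)}
    (h : ∀ j b, f (inc j b 1) = g (inc j b 1)) : f = g := by
  refine DFunLike.ext _ _ fun v => ?_
  obtain ⟨l, rfl⟩ := red_surjective v
  rw [← sum_inc (red n l)]
  simp only [map_sum, red, inc_intCast, map_zsmul, h]

theorem act_surjective : Function.Surjective (act (n := n)) := by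
  intro g
  choose l hl using fun j b => red_surjective (g (inc j b 1))
  let H : BlockMatrix k := fun i j => Matrix.of fun a b => l j b i a
  have hH : H ∈ S n := by
    rw [mem_S_iff]
    intro i j a b
    have h0 : g (n j • inc j b 1) = 0 := by
      rw [← map_nsmul, nsmul_one, ZMod.natCast_self, map_zero, map_zero]
    rw [map_nsmul, ← hl] at h0
    have := congrFun (congrFun h0 i) a
    change (n j) • ((l j b i a : ℤ) : ZMod (n i)) = 0 at this
    rw [← ZMod.intCast_zmod_eq_zero_iff_dvd]
    simpa [H] using this
  refine ⟨⟨H, hH⟩, end_ext fun j b => ?_⟩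
  rw [← red_latticeBasis, act_red, red_latticeBasis, ← hl]
  congr 1
  ext i a
  rw [mulLattice_basis]
  rfl

/-- `H^*` is the adjoint of `H` with respect to the symmetric pairing. -/
theorem dot_act (H : S n) (u v : PhaseSpace n) :
    dot (act H u) v = dot u (act (adjointS n H) v) := by
  obtain ⟨l, rfl⟩ := red_surjective u
  obtain ⟨m, rfl⟩ := red_surjective v
  rw [act_red, act_red, dot_red, dot_red]
  congr 1
  have h1 : ∀ i a, ((mulLattice H l i a * m i a : ℤ) : ℚ) / n i =
      ∑ j, ∑ b, ((H : BlockMatrix k) i j a b * l j b * m i a : ℚ) / n i := fun i a => by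
    simp only [mulLattice, Int.cast_mul, Int.cast_sum, Finset.sum_mul, Finset.sum_div]
  have h2 : ∀ j b, ((l j b * mulLattice (adjointS n H) m j b : ℤ) : ℚ) / n j =
      ∑ i, ∑ a, ((H : BlockMatrix k) i j a b * l j b * m i a : ℚ) / n i := fun j b => by
    simp only [mulLattice, Int.cast_mul, Int.cast_sum, Finset.mul_sum, Finset.sum_div]
    refine Finset.sum_congr rfl fun i _ => Finset.sum_congr rfl fun a _ => ?_
    have h : (n i : ℚ) * (adjointS n H : BlockMatrix k) j i b a =
        n j * (H : BlockMatrix k) i j a b := by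
      exact_mod_cast adjointMatrix_spec n H.2 j i b a
    have hi : (n i : ℚ) ≠ 0 := by exact_mod_cast NeZero.ne (n i)
    have hj : (n j : ℚ) ≠ 0 := by exact_mod_cast NeZero.ne (n j)
    rw [div_eq_div_iff hj hi]
    linear_combination (l j b * m i a : ℚ) * h
  simp only [h1, h2]
  calc _ = ∑ i, ∑ j, ∑ a, ∑ b, ((H : BlockMatrix k) i j a b * l j b * m i a : ℚ) / n i :=
        Finset.sum_congr rfl fun i _ => Finset.sum_comm
    _ = ∑ j, ∑ i, ∑ a, ∑ b, ((H : BlockMatrix k) i j a b * l j b * m i a : ℚ) / n i :=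
        Finset.sum_comm
    _ = ∑ j, ∑ i, ∑ b, ∑ a, ((H : BlockMatrix k) i j a b * l j b * m i a : ℚ) / n i :=
        Finset.sum_congr rfl fun j _ => Finset.sum_congr rfl fun i _ => Finset.sum_comm
    _ = _ := Finset.sum_congr rfl fun j _ => Finset.sum_comm

theorem dot_act_JS (u v : PhaseSpace n) : dot u (act (JS n) v) = form u v := by
  obtain ⟨l, rfl⟩ := red_surjective u
  obtain ⟨m, rfl⟩ := red_surjective v
  rw [act_red, dot_red, form_red]
  congr 1
  refine Finset.sum_congr rfl fun i _ => ?_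
  have h : ∀ a, mulLattice (JS n) m i a = ∑ b, !![0, 1; -1, 0] a b * m i b := fun a => by
    rw [mulLattice, Finset.sum_eq_single i]
    · simp [JS]
    · intro j _ hj
      simp [JS, Matrix.diagonal_apply_ne _ hj.symm]
    · simp
  simp only [h, Fin.sum_univ_two]
  simp
  ring

variable (n) in
/-- The monoid of endomorphisms of the phase space that preserve the commutation form. -/
def isometries : Submonoid (AddMonoid.End (PhaseSpace n)) where
  carrier := {g | ∀ u v, form (g u) (g v) = form u v}
  one_mem' _ _ := rfl
  mul_mem' {_ g} hf hg u v := (hf (g u) (g v)).trans (hg u v)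

theorem form_act (H : S n) (u v : PhaseSpace n) :
    form (act H u) (act H v) = dot u (act (adjointS n H * JS n * H) v) := by
  rw [← dot_act_JS, dot_act, act_mul, act_mul]
  rfl

theorem mem_Sp_iff (H : S n) : (H : M n) ∈ Sp n ↔ act H ∈ isometries n := by
  change ((adjointS n H * JS n * H : S n) : M n) = (JS n : M n) ↔ _
  rw [RingCon.eq, ← act_eq_iff]
  change _ ↔ ∀ u v, form (act H u) (act H v) = form u v
  simp only [form_act]
  simp only [← dot_act_JS]
  exact ⟨fun h u v => by rw [h], fun h => DFunLike.ext _ _ fun v => eq_of_dot_eq fun u => h u v⟩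

/-- An isometry of the phase space as an element of `Sp`. -/
noncomputable def isometriesToSp : isometries n →* Sp n where
  toFun g := ⟨((act_surjective g.1).choose : M n), by
    rw [mem_Sp_iff, (act_surjective g.1).choose_spec]; exact g.2⟩
  map_one' := by
    apply Subtype.ext
    refine (RingCon.eq _).2 ((act_eq_iff _ _).1 ?_)
    rw [(act_surjective _).choose_spec, act_one]
    rfl
  map_mul' f g := by
    apply Subtype.ext
    refine (RingCon.eq _).2 ((act_eq_iff _ _).1 ?_)
    rw [act_mul, (act_surjective _).choose_spec, (act_surjective _).choose_spec,
      (act_surjective _).choose_spec]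
    rfl

theorem isometriesToSp_bijective : Function.Bijective (isometriesToSp (n := n)) := by
  constructor
  · intro f g h
    have := (act_eq_iff _ _).2 ((RingCon.eq _).1 (congrArg Subtype.val h))
    rw [(act_surjective _).choose_spec, (act_surjective _).choose_spec] at this
    exact Subtype.ext this
  · rintro ⟨H, hH⟩
    induction H using Quotient.inductionOn with | _ H =>
    refine ⟨⟨act H, (mem_Sp_iff H).1 hH⟩, Subtype.ext ((RingCon.eq _).2 ((act_eq_iff _ _).1 ?_))⟩
    exact (act_surjective _).choose_spec

end Action

/-! ### Elementary isometries generate -/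

section Generation

/-- Two elements of `ℤ/n` have a linear combination of the form `a + c b` that divides both:
`ℤ/n` has stable range one. -/
theorem exists_add_nsmul_dvd {n : ℕ} [NeZero n] (a b : ZMod n) :
    ∃ c : ℕ, a + c • b ∣ a ∧ a + c • b ∣ b := by
  obtain ⟨x, rfl⟩ := ZMod.intCast_surjective a
  obtain ⟨y, rfl⟩ := ZMod.intCast_surjective b
  rcases eq_or_ne (Int.gcd x y) 0 with h0 | h0
  · obtain ⟨rfl, rfl⟩ := Int.gcd_eq_zero_iff.1 h0
    exact ⟨0, by simp⟩
  obtain ⟨x', y', hc, hx, hy⟩ := Int.exists_gcd_one (Nat.pos_of_ne_zero h0)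
  -- with this `c`, every prime factor of `n` divides exactly one of `x'` and `c y'`
  let c : ℕ := ∏ p ∈ n.primeFactors.filter fun p : ℕ => ¬ (p : ℤ) ∣ x', p
  have hcop : IsCoprime (x' + c * y') (n : ℤ) := by
    rw [Int.isCoprime_iff_gcd_eq_one]
    by_contra hne
    obtain ⟨p, hp, hpd⟩ := Nat.exists_prime_and_dvd hne
    have h1 : (p : ℤ) ∣ x' + c * y' := (Int.natCast_dvd_natCast.2 hpd).trans (Int.gcd_dvd_left ..)
    have h2 : p ∣ n := Int.natCast_dvd_natCast.1
      ((Int.natCast_dvd_natCast.2 hpd).trans (Int.gcd_dvd_right ..))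
    have hp' : Prime (p : ℤ) := Nat.prime_iff_prime_int.1 hp
    by_cases hx' : (p : ℤ) ∣ x'
    · rcases hp'.dvd_or_dvd ((dvd_add_right hx').1 h1) with h | h
      · have hpc : p ∣ c := by exact_mod_cast h
        obtain ⟨q, hq, hpq⟩ := (hp.prime.dvd_finsetProd_iff _).1 hpc
        rw [Finset.mem_filter] at hq
        rw [(Nat.prime_dvd_prime_iff_eq hp (Nat.prime_of_mem_primeFactors hq.1)).1 hpq] at hx'
        exact hq.2 hx'
      · have := Int.dvd_coe_gcd hx' h
        rw [hc] at this
        exact hp'.not_isUnit (isUnit_of_dvd_one (by exact_mod_cast this))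
    · have hpc : p ∣ c := Finset.dvd_prod_of_mem (fun p : ℕ => p)
        (Finset.mem_filter.2 ⟨Nat.mem_primeFactors.2 ⟨hp, h2, NeZero.ne n⟩, hx'⟩)
      exact hx' ((dvd_add_left ((Int.natCast_dvd_natCast.2 hpc).mul_right y')).1 h1)
  have hu : IsUnit ((x' + c * y' : ℤ) : ZMod n) := by
    obtain ⟨s, t, hst⟩ := hcop
    refine IsUnit.of_mul_eq_one ((s : ℤ) : ZMod n) ?_
    have := congrArg (Int.cast : ℤ → ZMod n) hst
    push_cast at this ⊢
    rw [ZMod.natCast_self, mul_zero, add_zero] at this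
    rw [mul_comm, this]
  have he : (x : ZMod n) + c • (y : ZMod n) =
      ((x' + c * y' : ℤ) : ZMod n) * ((Int.gcd x y : ℤ) : ZMod n) := by
    have hx' := congrArg (Int.cast : ℤ → ZMod n) hx
    have hy' := congrArg (Int.cast : ℤ → ZMod n) hy
    push_cast at hx' hy' ⊢
    rw [nsmul_eq_mul, add_mul, mul_assoc, ← hx', ← hy']
  refine ⟨c, ?_⟩
  rw [he, hu.mul_left_dvd, hu.mul_left_dvd]
  exact ⟨Int.cast_dvd_cast _ _ (Int.gcd_dvd_left ..), Int.cast_dvd_cast _ _ (Int.gcd_dvd_right ..)⟩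

variable {k : ℕ} {n : Fin k → ℕ} [∀ i, NeZero (n i)]

/-- Multiplication by `n_i / gcd (n_i, n_j)` as a map `ℤ/n_j → ℤ/n_i`. -/
def mulRatio (i j : Fin k) : ZMod (n j) →+ ZMod (n i) :=
  ZMod.lift (n j) ⟨zmultiplesHom (ZMod (n i)) (ratio n i j : ZMod (n i)), by
    have := (ZMod.intCast_zmod_eq_zero_iff_dvd _ (n i)).2 (dvd_mul_ratio n i j)
    simpa using this⟩

theorem mulRatio_intCast (i j : Fin k) (m : ℤ) :
    mulRatio i j (m : ZMod (n j)) = ((ratio n i j * m : ℤ) : ZMod (n i)) := by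
  simp [mulRatio, mul_comm]

theorem mulRatio_self (i : Fin k) (x : ZMod (n i)) : mulRatio i i x = x := by
  obtain ⟨m, rfl⟩ := ZMod.intCast_surjective x
  rw [mulRatio_intCast, ratio_self, one_mul]

/-- The elements of `ℤ/n_j` killed by `n_i` are the multiples of `n_j / gcd (n_i, n_j)`. -/
theorem exists_mulRatio_eq (i j : Fin k) (x : ZMod (n j)) (hx : n i • x = 0) :
    ∃ t : ℤ, mulRatio j i (t : ZMod (n i)) = x := by
  obtain ⟨m, rfl⟩ := ZMod.intCast_surjective x
  have h : (n j : ℤ) ∣ n i * m := by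
    rw [← ZMod.intCast_zmod_eq_zero_iff_dvd]
    simpa using hx
  obtain ⟨t, rfl⟩ := (ratio_dvd_iff n j i m).2 h
  exact ⟨t, mulRatio_intCast j i t⟩

/-- If `v` pairs with some `w` of the order of the `i`-th factor to the basic root of unity, then
the coordinates of all `(n_i / gcd (n_i, n_j)) v_j` have only units as common divisors in `ℤ/n_i`. -/
theorem isUnit_of_forall_dvd {i : Fin k} {v w : PhaseSpace n} (hw : n i • w = 0)
    (h : form v w = rootChar (n i) 1) {d : ZMod (n i)} (hd : ∀ j b, d ∣ mulRatio i j (v j b)) :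
    IsUnit d := by
  choose t ht using fun j b => exists_mulRatio_eq i j (w j b) (congrFun (congrFun hw j) b)
  obtain ⟨l, rfl⟩ := red_surjective v
  have hw' : w = red n fun j b => ratio n j i * t j b := by
    ext j b
    rw [← ht, mulRatio_intCast]
    rfl
  have h1 : rootChar (n i) 1 = ratChar ((1 : ℚ) / n i) := by
    simpa using rootChar_intCast (n i) 1
  rw [hw', form_red, h1, ratChar_eq_iff] at h
  obtain ⟨m, hm⟩ := h
  have hi : (n i : ℚ) ≠ 0 := by exact_mod_cast NeZero.ne (n i)
  have hterm : ∀ j, ((l j 0 * (ratio n j i * t j 1) - l j 1 * (ratio n j i * t j 0) : ℤ) : ℚ) / n j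
      = ((ratio n i j * l j 0 * t j 1 - ratio n i j * l j 1 * t j 0 : ℤ) : ℚ) / n i := fun j => by
    have hj : (n j : ℚ) ≠ 0 := by exact_mod_cast NeZero.ne (n j)
    have hr : (n j : ℚ) * ratio n i j = n i * ratio n j i := by
      exact_mod_cast mul_ratio_comm n i j
    rw [div_eq_div_iff hj hi]
    push_cast
    linear_combination (l j 1 * t j 0 - l j 0 * t j 1 : ℚ) * hr
  rw [Finset.sum_congr rfl fun j _ => hterm j, ← Finset.sum_div, ← sub_div, div_eq_iff hi] at hm
  have hm' : ∑ j, (ratio n i j * l j 0 * t j 1 - ratio n i j * l j 1 * t j 0) - 1 = m * n i := by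
    exact_mod_cast hm
  have hz := congrArg (Int.cast : ℤ → ZMod (n i)) hm'
  push_cast at hz
  rw [ZMod.natCast_self, mul_zero, sub_eq_zero] at hz
  apply isUnit_of_dvd_one
  rw [← hz]
  have hd' : ∀ j b, d ∣ (ratio n i j : ZMod (n i)) * l j b := fun j b => by
    have := hd j b
    rw [red, mulRatio_intCast] at this
    exact_mod_cast this
  exact Finset.dvd_sum fun j _ => dvd_sub ((hd' j 0).mul_right _) ((hd' j 1).mul_right _)

theorem nsmul_inc (i : Fin k) (b : Fin 2) (x : ZMod (n i)) : n i • inc i b x = 0 := by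
  rw [← map_nsmul, nsmul_eq_mul, ZMod.natCast_self, zero_mul, map_zero]

/-- An isometry that fixes the `j`-th component preserves its orthogonal complement. -/
theorem isometry_apply_eq_zero {g : AddMonoid.End (PhaseSpace n)} (hg : g ∈ isometries n)
    {j : Fin k} (hj : ∀ b, g (inc j b 1) = inc j b 1) {v : PhaseSpace n} (hv : v j = 0) :
    g v j = 0 := by
  have hf : ∀ b, form (inc j b 1) (g v) = 1 := fun b => by
    have h1 := hg (inc j b 1) v
    rw [hj] at h1
    rw [h1]
    fin_cases b <;> simp [form_inc_zero, form_inc_one, hv]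
  have h0 := hf 1
  have h1 := hf 0
  rw [form_inc_one, rootChar_eq_one_iff, one_mul, neg_eq_zero] at h0
  rw [form_inc_zero, rootChar_eq_one_iff, one_mul] at h1
  ext b
  fin_cases b
  · exact h0
  · exact h1

/-- A group `C` of isometries of the phase space, given as a submonoid of the endomorphisms, which
contains the elementary ones: the shears `x_i ↦ x_i + y_i`, the rotations
`(x_i, y_i) ↦ (-y_i, x_i)`, and the shears that couple two factors. -/
structure IsElementary (C : Submonoid (AddMonoid.End (PhaseSpace n))) : Prop where
  isometry : C ≤ isometries n
  inv : ∀ g ∈ C, ∃ h ∈ C, h * g = 1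
  shear : ∀ i, ∃ g ∈ C, ∀ v, g v = v + inc i 0 (v i 1)
  rot : ∀ i, ∃ g ∈ C, ∀ v, g v = Function.update v i ![-v i 1, v i 0]
  couple : ∀ i j, i ≠ j → ∃ g ∈ C, ∀ v,
    g v = v + (inc i 0 (mulRatio i j (v j 1)) + inc j 0 (mulRatio j i (v i 1)))

/-- `v` can be moved to `w` by an element of `C` that fixes all vectors in `X`. -/
def Reach (C : Submonoid (AddMonoid.End (PhaseSpace n))) (X : Set (PhaseSpace n))
    (v w : PhaseSpace n) : Prop :=
  ∃ g ∈ C, (∀ x ∈ X, g x = x) ∧ g v = w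

variable {C : Submonoid (AddMonoid.End (PhaseSpace n))} {X : Set (PhaseSpace n)}

theorem Reach.refl (v : PhaseSpace n) : Reach C X v v :=
  ⟨1, C.one_mem, fun _ _ => rfl, rfl⟩

theorem Reach.trans {u v w : PhaseSpace n} (h : Reach C X u v) (h' : Reach C X v w) :
    Reach C X u w := by
  obtain ⟨f, hf, hfX, rfl⟩ := h
  obtain ⟨g, hg, hgX, rfl⟩ := h'
  exact ⟨g * f, C.mul_mem hg hf,
    fun x hx => (congrArg g (hfX x hx)).trans (hgX x hx), rfl⟩

theorem Reach.nsmul_eq_zero {v w : PhaseSpace n} (h : Reach C X v w) {m : ℕ} (hv : m • v = 0) :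
    m • w = 0 := by
  obtain ⟨g, -, -, rfl⟩ := h
  rw [← map_nsmul, hv, map_zero]

/-- Iterating a transvection `v ↦ v + N v`. -/
theorem reach_add_nsmul {g : AddMonoid.End (PhaseSpace n)} (hg : g ∈ C)
    {N : PhaseSpace n → PhaseSpace n} (hN : ∀ v, g v = v + N v)
    (hNN : ∀ (c : ℕ) v, N (v + c • N v) = N v) (hX : ∀ x ∈ X, N x = 0) (c : ℕ)
    (v : PhaseSpace n) : Reach C X v (v + c • N v) := by
  induction c with
  | zero => simpa using Reach.refl v
  | succ c ih =>
    refine ih.trans ⟨g, hg, fun x hx => by rw [hN, hX x hx, add_zero], ?_⟩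
    rw [hN, hNN, add_assoc, succ_nsmul]

namespace IsElementary

variable (hC : IsElementary C)
include hC

theorem reach_shear {i : Fin k} (hX : ∀ x ∈ X, x i 1 = 0) (c : ℕ) (v : PhaseSpace n) :
    Reach C X v (v + inc i 0 (c • v i 1)) := by
  obtain ⟨g, hg, hgv⟩ := hC.shear i
  have := reach_add_nsmul (X := X) (N := fun v => inc i 0 (v i 1)) hg hgv (fun c v => ?_)
    (fun x hx => by simp [hX x hx]) c v
  · simpa only [map_nsmul] using this
  · simp [inc_same]

theorem reach_rot {i : Fin k} (hX : ∀ x ∈ X, x i = 0) (v : PhaseSpace n) :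
    Reach C X v (Function.update v i ![-v i 1, v i 0]) := by
  obtain ⟨g, hg, hgv⟩ := hC.rot i
  refine ⟨g, hg, fun x hx => ?_, hgv v⟩
  rw [hgv, Function.update_eq_self_iff, hX x hx]
  ext b
  fin_cases b <;> simp

theorem reach_couple {i j : Fin k} (hij : i ≠ j) (hXi : ∀ x ∈ X, x i 1 = 0)
    (hXj : ∀ x ∈ X, x j 1 = 0) (c : ℕ) (v : PhaseSpace n) :
    Reach C X v (v + (inc i 0 (c • mulRatio i j (v j 1)) + inc j 0 (c • mulRatio j i (v i 1)))) := by
  obtain ⟨g, hg, hgv⟩ := hC.couple i j hij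
  have := reach_add_nsmul (X := X)
    (N := fun v => inc i 0 (mulRatio i j (v j 1)) + inc j 0 (mulRatio j i (v i 1))) hg hgv
    (fun c v => ?_) (fun x hx => by simp [hXi x hx, hXj x hx]) c v
  · simpa only [nsmul_add, map_nsmul] using this
  · simp [inc_same, inc_ne hij, inc_ne hij.symm]

/-- A vector of order `n_i` with a unit as its `i`-th `P`-exponent can be cleared at the `j`-th
component. -/
theorem exists_reach_clear_component {i j : Fin k} (hij : j ≠ i) (hXi : ∀ x ∈ X, x i 1 = 0)
    (hXj : ∀ x ∈ X, x j = 0) {v : PhaseSpace n} (hv : n i • v = 0) (hu : IsUnit (v i 1)) :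
    ∃ w, Reach C X v w ∧ w i 1 = v i 1 ∧ w j = 0 ∧ ∀ m, m ≠ i → m ≠ j → w m = v m := by
  have hX1 : ∀ x ∈ X, x j 1 = 0 := fun x hx => by simp [hXj x hx]
  -- clear the `Q`-exponent by a coupling, rotate, and clear again
  have key : ∀ v : PhaseSpace n, n i • v = 0 → IsUnit (v i 1) → ∃ w, Reach C X v w ∧
      w i 1 = v i 1 ∧ w j 0 = 0 ∧ w j 1 = v j 1 ∧ ∀ m, m ≠ i → m ≠ j → w m = v m := by
    intro v hv hu
    obtain ⟨t, ht⟩ := exists_mulRatio_eq i j (v j 0) (congrFun (congrFun hv j) 0)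
    obtain ⟨s, hs⟩ := hu.exists_left_inv
    let c : ℕ := (-(t : ZMod (n i)) * s).val
    refine ⟨_, hC.reach_couple hij.symm hXi hX1 c v, ?_, ?_, ?_, ?_⟩
    · simp [inc_same, inc_ne hij.symm]
    · have : c • v i 1 = -(t : ZMod (n i)) := by
        rw [nsmul_eq_mul, ZMod.natCast_zmod_val, mul_assoc, hs, mul_one]
      simp only [Pi.add_apply, inc_same, inc_ne hij, if_true]
      rw [← map_nsmul, this, map_neg, ht]
      simp
    · simp [inc_same, inc_ne hij]
    · intro m hmi hmj
      simp [inc_ne hmi, inc_ne hmj]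
  obtain ⟨w, hw, hwi, hw0, hw1, hwm⟩ := key v hv hu
  let w' := Function.update w j ![-w j 1, w j 0]
  have hr : Reach C X v w' := hw.trans (hC.reach_rot hXj w)
  have hi : w' i = w i := Function.update_of_ne hij.symm _ _
  have hj : w' j = ![-w j 1, w j 0] := Function.update_self _ _ _
  obtain ⟨z, hz, hzi, hz0, hz1, hzm⟩ := key w' (hr.nsmul_eq_zero hv) (by rwa [hi, hwi])
  refine ⟨z, hr.trans hz, by rw [hzi, hi, hwi], ?_, fun m hmi hmj => ?_⟩
  · ext b
    fin_cases b
    · exact hz0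
    · exact hz1.trans (by simp [hj, hw0])
  · rw [hzm m hmi hmj, ← hwm m hmi hmj]
    exact Function.update_of_ne hmj _ _

/-- Clearing all components but the `i`-th one by one, and then the `Q`-exponent there. Only a unit
`P`-exponent is used as a pivot, so that vectors without `P`-exponent at `i` can be kept fixed. -/
theorem reach_inc_one {i : Fin k} (hXi : ∀ x ∈ X, x i 1 = 0) {v : PhaseSpace n}
    (hv : n i • v = 0) (hu : IsUnit (v i 1))
    (hX : ∀ j, j ≠ i → v j = 0 ∨ ∀ x ∈ X, x j = 0) :
    Reach C X v (inc i 1 (v i 1)) := by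
  have key : ∀ F : Finset (Fin k), i ∉ F → ∃ w, Reach C X v w ∧ w i 1 = v i 1 ∧
      (∀ j ∈ F, w j = 0) ∧ ∀ m, m ≠ i → m ∉ F → w m = v m := by
    intro F
    induction F using Finset.induction_on with
    | empty => exact fun _ => ⟨v, Reach.refl v, rfl, by simp, by simp⟩
    | insert j F hj ih =>
      intro hiF
      rw [Finset.mem_insert, not_or] at hiF
      obtain ⟨w, hw, hwi, hwF, hwm⟩ := ih hiF.2
      rcases hX j (Ne.symm hiF.1) with h0 | h0
      · refine ⟨w, hw, hwi, fun m hm => ?_, fun m hmi hm => ?_⟩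
        · rcases Finset.mem_insert.1 hm with rfl | hm
          · rw [hwm m (Ne.symm hiF.1) hj, h0]
          · exact hwF m hm
        · exact hwm m hmi fun h => hm (Finset.mem_insert_of_mem h)
      · obtain ⟨z, hz, hzi, hzj, hzm⟩ := hC.exists_reach_clear_component (Ne.symm hiF.1) hXi h0
          (hw.nsmul_eq_zero hv) (by rwa [hwi])
        refine ⟨z, hw.trans hz, hzi.trans hwi, fun m hm => ?_, fun m hmi hm => ?_⟩
        · rcases eq_or_ne m j with rfl | hmj
          · exact hzj
          · have hmF := (Finset.mem_insert.1 hm).resolve_left hmj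
            rw [hzm m (fun h => hiF.2 (h ▸ hmF)) hmj, hwF m hmF]
        · rw [Finset.mem_insert, not_or] at hm
          rw [hzm m hmi hm.1, hwm m hmi hm.2]
  obtain ⟨w, hw, hwi, hwF, -⟩ := key (Finset.univ.erase i) (Finset.notMem_erase _ _)
  obtain ⟨s, hs⟩ := hu.exists_left_inv
  have := hC.reach_shear hXi (-(w i 0) * s).val w
  refine hw.trans ?_
  convert this using 1
  ext j b
  rcases eq_or_ne j i with rfl | hj
  · fin_cases b
    · simp [inc_same, nsmul_eq_mul, hwi, mul_assoc, hs]
    · simp [inc_same, hwi]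
  · simp [inc_ne hj, hwF j (by simp [hj])]

/-- A vector `(0, t)` with `t` a unit can be moved to `(1, 0)` within the `i`-th component. -/
theorem reach_inc_zero_of_isUnit {i : Fin k} (hX : ∀ x ∈ X, x i = 0) {t : ZMod (n i)}
    (ht : IsUnit t) : Reach C X (inc i 1 t) (inc i 0 1) := by
  have hX1 : ∀ x ∈ X, x i 1 = 0 := fun x hx => by simp [hX x hx]
  have rot : ∀ x y : ZMod (n i), Reach C X (inc i 0 x + inc i 1 y) (inc i 0 (-y) + inc i 1 x) := by
    intro x y
    have := hC.reach_rot hX (inc i 0 x + inc i 1 y)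
    convert this using 1
    ext j b
    rcases eq_or_ne j i with rfl | hj
    · fin_cases b <;> simp [inc_same]
    · simp [inc_ne hj, Function.update_of_ne hj]
  have shear : ∀ x y c : ZMod (n i),
      Reach C X (inc i 0 x + inc i 1 y) (inc i 0 (x + c * y) + inc i 1 y) := by
    intro x y c
    have := hC.reach_shear hX1 c.val (inc i 0 x + inc i 1 y)
    convert this using 1
    simp [inc_same, nsmul_eq_mul, add_right_comm]
  obtain ⟨s, hs⟩ := ht.exists_left_inv
  -- `(0, t) → (1, t) → (-t, 1) → (0, 1) → (-1, 0) → (0, -1) → (1, 0)`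
  have h1 := (shear 0 t s).trans (rot _ _)
  have h2 := h1.trans (shear _ _ t)
  have h3 := ((h2.trans (rot _ _)).trans (rot _ _)).trans (rot _ _)
  simpa [hs] using h3

/-- By isometries fixing the components in `s`, a vector that is orthogonal to these components and
generates a direct summand of order `n_i` can be moved to the basis vector at `i`. The point is that
in the orbit, a vector whose `i`-th `Q`-exponent generates a maximal ideal of `ℤ/n_i` must have
a unit there. -/
theorem reach_inc_zero {s : Set (Fin k)} {i : Fin k} (hi : i ∉ s) {v w : PhaseSpace n}
    (hv : n i • v = 0) (hw : n i • w = 0) (hvw : form v w = rootChar (n i) 1)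
    (hs : ∀ j ∈ s, v j = 0) :
    Reach C {x | ∃ j ∈ s, ∃ b, x = inc j b 1} v (inc i 0 1) := by
  set X : Set (PhaseSpace n) := {x | ∃ j ∈ s, ∃ b, x = inc j b 1}
  have hX : ∀ j ∉ s, ∀ x ∈ X, x j = 0 := by
    rintro j hj x ⟨m, hm, b, rfl⟩
    exact inc_ne (by rintro rfl; exact hj hm) _ _
  have hX1 : ∀ j ∉ s, ∀ x ∈ X, x j 1 = 0 := fun j hj x hx => by rw [hX j hj x hx]; rfl
  -- the invariants of the orbit
  have hinv : ∀ u, Reach C X v u → ∃ w', n i • w' = 0 ∧ form u w' = rootChar (n i) 1 ∧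
      ∀ j ∈ s, u j = 0 := by
    rintro u ⟨g, hg, hgX, rfl⟩
    have hgi := hC.isometry hg
    exact ⟨g w, by rw [← map_nsmul, hw, map_zero], (hgi v w).trans hvw, fun j hj =>
      isometry_apply_eq_zero hgi (fun b => hgX _ ⟨j, hj, b, rfl⟩) (hs j hj)⟩
  obtain ⟨u, hu, hmax⟩ : ∃ u, Reach C X v u ∧ ∀ u', Reach C X v u' →
      ¬ Ideal.span {u i 0} < Ideal.span {u' i 0} := by
    obtain ⟨I, ⟨u, hu, rfl⟩, hI⟩ := (wellFounded_gt (α := Ideal (ZMod (n i)))).has_min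
      ((fun u : PhaseSpace n => Ideal.span {u i 0}) '' {u | Reach C X v u})
      ⟨_, v, Reach.refl v, rfl⟩
    exact ⟨u, hu, fun u' hu' => hI _ ⟨u', hu', rfl⟩⟩
  -- by maximality, anything that can be added repeatedly to the exponent is a multiple of it
  have hdvd : ∀ b : ZMod (n i),
      (∀ c : ℕ, ∃ u', Reach C X u u' ∧ u' i 0 = u i 0 + c • b) → u i 0 ∣ b := by
    intro b hb
    obtain ⟨c, hc, hcb⟩ := exists_add_nsmul_dvd (u i 0) b
    obtain ⟨u', hu', h'⟩ := hb c
    rw [← h'] at hc hcb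
    have hle := Ideal.span_singleton_le_span_singleton.2 hc
    have := eq_of_le_of_not_lt hle (hmax u' (hu.trans hu'))
    rw [← Ideal.mem_span_singleton, this, Ideal.mem_span_singleton]
    exact hcb
  obtain ⟨w', hw', hform, hus⟩ := hinv u hu
  have hunit : IsUnit (u i 0) := by
    refine isUnit_of_forall_dvd hw' hform fun j b => ?_
    by_cases hj : j ∈ s
    · simp [hus j hj]
    rcases eq_or_ne j i with rfl | hji
    · rw [mulRatio_self]
      fin_cases b
      · exact dvd_rfl
      · exact hdvd _ fun c => ⟨_, hC.reach_shear (hX1 j hi) c u, by simp [inc_same]⟩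
    · fin_cases b
      · refine hdvd _ fun c => ⟨_, (hC.reach_rot (hX j hj) u).trans
          (hC.reach_couple hji.symm (hX1 i hi) (hX1 j hj) c _), ?_⟩
        simp [inc_same, inc_ne hji.symm, Function.update_of_ne hji.symm]
      · refine hdvd _ fun c => ⟨_, hC.reach_couple hji.symm (hX1 i hi) (hX1 j hj) c _, ?_⟩
        simp [inc_same, inc_ne hji.symm]
  have hr := hu.trans (hC.reach_rot (hX i hi) u)
  have h1 := hC.reach_inc_one (X := X) (hX1 i hi) (hr.nsmul_eq_zero hv)
    (by simpa using hunit) fun j hji => by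
      by_cases hj : j ∈ s
      · left
        rw [Function.update_of_ne hji, hus j hj]
      · exact Or.inr (hX j hj)
  refine (hr.trans h1).trans (hC.reach_inc_zero_of_isUnit (hX i hi) ?_)
  simpa using hunit

/-- The elementary isometries generate: the images of the basis vectors are moved back to the basis
vectors one component after the other. -/
theorem isometries_le : isometries n ≤ C := by
  suffices h : ∀ F : Finset (Fin k), ∀ g ∈ isometries n,
      (∀ j ∉ F, ∀ b, g (inc j b 1) = inc j b 1) → g ∈ C from
    fun g hg => h Finset.univ g hg (by simp)
  intro F
  induction F using Finset.induction_on with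
  | empty =>
    intro g _ h
    rw [show g = 1 from end_ext fun j b => h j (by simp) b]
    exact C.one_mem
  | insert i F hiF ih =>
    intro g hg hfix
    let s : Set (Fin k) := {j | j ∉ insert i F}
    have his : i ∉ s := by simp [s]
    have hord : ∀ b, n i • g (inc i b 1) = 0 := fun b => by
      rw [← map_nsmul, nsmul_inc, map_zero]
    have horth : ∀ b, ∀ j ∈ s, g (inc i b 1) j = 0 := fun b j hj =>
      isometry_apply_eq_zero hg (hfix j hj) (inc_ne (by rintro rfl; exact his hj) _ _)
    have hpair : form (inc i 0 1) (inc (n := n) i 1 1) = rootChar (n i) 1 := by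
      rw [form_inc_zero, inc_same]; simp
    obtain ⟨p, hp, hpX, hpe⟩ := hC.reach_inc_zero his (hord 0) (hord 1)
      ((hg _ _).trans hpair) (horth 0)
    -- `p g` fixes the first basis vector; correct the second one by elements fixing the first
    let u := p (g (inc i 1 1))
    have hfu : form (inc i 0 1) u = rootChar (n i) 1 := by
      rw [← hpe]
      exact (hC.isometry hp _ _).trans ((hg _ _).trans hpair)
    have hu1 : u i 1 = 1 := by
      rw [form_inc_zero, one_mul] at hfu
      exact rootChar_injective _ hfu
    have hus : ∀ j ∈ s, u j = 0 := fun j hj =>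
      isometry_apply_eq_zero (hC.isometry hp) (fun b => hpX _ ⟨j, hj, b, rfl⟩) (horth 1 j hj)
    obtain ⟨q, hq, hqX, hqu⟩ := hC.reach_inc_one
      (X := insert (inc i 0 1) {x | ∃ j ∈ s, ∃ b, x = inc j b 1}) (i := i) (v := u)
      (by
        rintro x (rfl | ⟨j, hj, b, rfl⟩)
        · simp [inc_same]
        · rw [inc_ne (by rintro rfl; exact his hj)]; rfl)
      (by rw [← map_nsmul, hord, map_zero]) (by rw [hu1]; exact isUnit_one)
      (by
        intro j hji
        by_cases hj : j ∈ s
        · exact Or.inl (hus j hj)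
        · right
          rintro x (rfl | ⟨m, hm, b, rfl⟩)
          · exact inc_ne hji _ _
          · exact inc_ne (by rintro rfl; exact hj hm) _ _)
    rw [hu1] at hqu
    have hqp : q * p ∈ C := C.mul_mem hq hp
    have hmem : q * p * g ∈ C := by
      refine ih _ ((isometries n).mul_mem (hC.isometry hqp) hg) fun j hj b => ?_
      change q (p (g (inc j b 1))) = _
      rcases eq_or_ne j i with rfl | hji
      · fin_cases b
        · exact (congrArg q hpe).trans (hqX _ (Set.mem_insert _ _))
        · exact hqu
      · have hjs : j ∈ s := by simp [s, hj, hji]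
        rw [hfix j hjs, hpX _ ⟨j, hjs, b, rfl⟩, hqX _ (Or.inr ⟨j, hjs, b, rfl⟩)]
    obtain ⟨r, hr, hrq⟩ := hC.inv _ hqp
    have : g = r * (q * p * g) := by rw [← mul_assoc, hrq, one_mul]
    rw [this]
    exact C.mul_mem hr hmem

end IsElementary

end Generation

/-! ### Inner automorphisms and scalars -/

section Projective

variable {ι : Type} [Fintype ι] [DecidableEq ι]

instance : IsScalarTower ℂˣ (GL ι ℂ) (GL ι ℂ) :=
  ⟨fun c X Y => Units.ext (smul_mul_assoc c X.val Y.val)⟩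

instance : SMulCommClass ℂˣ (GL ι ℂ) (GL ι ℂ) :=
  ⟨fun c X Y => Units.ext (mul_smul_comm c X.val Y.val).symm⟩

theorem Ad_eq_iff (X Y : GL ι ℂ) : Ad X = Ad Y ↔ ∃ c : ℂˣ, X = c • Y := by
  constructor
  · intro h
    have h1 : ∀ Z, X * Z * X⁻¹ = Y * Z * Y⁻¹ := fun Z =>
      DFunLike.congr_fun (congrArg Subtype.val h : MulAut.conj X = MulAut.conj Y) Z
    have h2 : Y⁻¹ * X ∈ Subgroup.center (GL ι ℂ) := by
      rw [Subgroup.mem_center_iff]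
      intro Z
      have := h1 Z
      rw [mul_inv_eq_iff_eq_mul] at this
      rw [mul_assoc, this]
      group
    rw [Matrix.GeneralLinearGroup.center_eq_range_scalar] at h2
    obtain ⟨c, hc⟩ := h2
    refine ⟨c, ?_⟩
    rw [← mul_inv_cancel_left Y X, ← hc]
    ext x y
    simp [Matrix.GeneralLinearGroup.scalar, Units.smul_def, mul_comm]
  · rintro ⟨c, rfl⟩
    refine Subtype.ext (MulEquiv.ext fun Z => ?_)
    change (c • Y) * Z * (c • Y)⁻¹ = Y * Z * Y⁻¹
    rw [smul_inv, smul_mul_assoc, smul_mul_assoc, mul_smul_comm, smul_inv_smul]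

theorem Ad_smul (c : ℂˣ) (X : GL ι ℂ) : Ad (c • X) = Ad X :=
  (Ad_eq_iff _ _).2 ⟨c, rfl⟩

theorem Ad_surjective : Function.Surjective (Ad : GL ι ℂ → InnGL ι) :=
  MonoidHom.rangeRestrict_surjective _

theorem smul_GL_cancel [Nonempty ι] {c d : ℂˣ} {X : GL ι ℂ} (h : c • X = d • X) : c = d := by
  have h1 : c • (1 : GL ι ℂ) = d • 1 := by
    rw [← mul_inv_cancel X, ← smul_mul_assoc, ← smul_mul_assoc, h]
  obtain ⟨x⟩ := ‹Nonempty ι›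
  have := congrArg (fun Z : GL ι ℂ => Z.val x x) h1
  ext
  simpa [Units.smul_def] using this

end Projective

/-! ### Weyl operators of a single factor -/

section LocalWeyl

variable (n : ℕ) [NeZero n]

/-- The Weyl operator of a single factor, which is `Q_n ^ a P_n ^ b` for the vector `(a, b)`. -/
noncomputable def localWeyl (v : Fin 2 → ZMod n) : GL (ZMod n) ℂ where
  val := Matrix.of fun x y => if y = x + v 1 then (rootChar n (v 0 * x) : ℂ) else 0
  inv := Matrix.of fun x y => if x = y + v 1 then ((rootChar n (v 0 * y))⁻¹ : ℂˣ) else (0 : ℂ)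
  val_inv := by
    ext x z
    rw [Matrix.mul_apply, Finset.sum_eq_single (x + v 1)]
    · by_cases h : x = z
      · subst h; simp
      · simp [h]
    · intro y _ hy
      simp [hy]
    · simp
  inv_val := by
    ext x z
    rw [Matrix.mul_apply, Finset.sum_eq_single (x - v 1)]
    · by_cases h : x = z
      · subst h; simp
      · simp [h, Ne.symm h]
    · intro y _ hy
      have : x ≠ y + v 1 := fun h => hy (eq_sub_of_add_eq h.symm)
      simp [this]
    · simp

variable {n}

theorem localWeyl_apply (v : Fin 2 → ZMod n) (x y : ZMod n) : (localWeyl n v).val x y =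
    if y = x + v 1 then (rootChar n (v 0 * x) : ℂ) else 0 := rfl

theorem localWeyl_mul (u v : Fin 2 → ZMod n) : localWeyl n u * localWeyl n v =
    rootChar n (v 0 * u 1) • localWeyl n (u + v) := by
  ext x z
  rw [Units.val_mul, Matrix.mul_apply, Units.val_smul, Finset.sum_eq_single (x + u 1)]
  · simp only [localWeyl_apply, if_true, Matrix.smul_apply, Units.smul_def, smul_eq_mul, mul_ite,
      mul_zero, Pi.add_apply, add_assoc]
    refine if_congr Iff.rfl ?_ rfl
    rw [← Units.val_mul, ← Units.val_mul, ← AddChar.map_add_eq_mul, ← AddChar.map_add_eq_mul]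
    congr 2
    ring
  · intro y _ hy
    simp [localWeyl_apply, hy]
  · simp

theorem localWeyl_zero : localWeyl n 0 = 1 := by
  ext x y
  simp [localWeyl_apply, Matrix.one_apply, eq_comm]

theorem localWeyl_Q : localWeyl n ![1, 0] = pauliQ n := by
  ext x y
  simp [localWeyl_apply, pauliQ, diagGL, Matrix.diagonal_apply, eq_comm, rootChar,
    AddChar.zmodChar_apply]

theorem localWeyl_P : localWeyl n ![0, 1] = pauliP n := by
  ext x y
  simp [localWeyl_apply, pauliP, eq_sub_iff_add_eq, eq_comm]

theorem Ad_localWeyl_add (u v : Fin 2 → ZMod n) :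
    Ad (localWeyl n (u + v)) = Ad (localWeyl n u) * Ad (localWeyl n v) := by
  rw [← map_mul, localWeyl_mul, Ad_smul]

/-- `v ↦ Ad_{w(v)}` as a homomorphism. -/
noncomputable def localWeylHom : Multiplicative (Fin 2 → ZMod n) →* InnGL (ZMod n) where
  toFun v := Ad (localWeyl n v.toAdd)
  map_one' := by rw [toAdd_one, localWeyl_zero, map_one]
  map_mul' u v := by rw [toAdd_mul, Ad_localWeyl_add]

theorem mem_pauliAd_iff (φ : InnGL (ZMod n)) :
    φ ∈ pauliAd n ↔ ∃ v, φ = Ad (localWeyl n v) := by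
  constructor
  · intro h
    have : pauliAd n ≤ localWeylHom.range := by
      rw [pauliAd, Subgroup.closure_le]
      rintro _ (rfl | rfl)
      · exact ⟨Multiplicative.ofAdd ![1, 0], congrArg Ad localWeyl_Q⟩
      · exact ⟨Multiplicative.ofAdd ![0, 1], congrArg Ad localWeyl_P⟩
    obtain ⟨v, rfl⟩ := this h
    exact ⟨v.toAdd, rfl⟩
  · rintro ⟨v, rfl⟩
    have hv : v = (v 0).val • ![1, 0] + (v 1).val • ![0, 1] := by
      ext b
      fin_cases b <;> simp
    have : Ad (localWeyl n v) = Ad (pauliQ n) ^ (v 0).val * Ad (pauliP n) ^ (v 1).val := by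
      rw [← localWeyl_Q, ← localWeyl_P]
      conv_lhs => rw [hv]
      rw [Ad_localWeyl_add]
      exact congrArg₂ _ (map_pow localWeylHom (Multiplicative.ofAdd ![1, 0]) _)
        (map_pow localWeylHom (Multiplicative.ofAdd ![0, 1]) _)
    rw [this]
    exact mul_mem (pow_mem (Subgroup.subset_closure (by simp)) _)
      (pow_mem (Subgroup.subset_closure (by simp)) _)

theorem heisenberg_map_Ad : (heisenberg n).map Ad = pauliAd n := by
  rw [heisenberg, MonoidHom.map_closure, Set.image_pair, pauliAd]

instance : Finite (pauliAd n : Set (InnGL (ZMod n))) :=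
  (Set.finite_range fun v => Ad (localWeyl n v)).subset fun φ h => by
    obtain ⟨v, rfl⟩ := (mem_pauliAd_iff φ).1 h
    exact ⟨v, rfl⟩

end LocalWeyl

/-! ### Weyl operators and the Pauli group -/

section Weyl

variable {k : ℕ} {n : Fin k → ℕ} [∀ i, NeZero (n i)]

theorem tensor_smul (c : ∀ _ : Fin k, ℂˣ) (X : ∀ i, GL (ZMod (n i)) ℂ) :
    tensor n (fun i => c i • X i) = (∏ i, c i) • tensor n X := by
  ext x y
  change ∏ i, (c i • X i).val (x i) (y i) = ((∏ i, c i : ℂˣ) : ℂ) * ∏ i, (X i).val (x i) (y i)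
  rw [Units.coe_prod, ← Finset.prod_mul_distrib]
  rfl

/-- The Weyl operator of a vector of the phase space. -/
noncomputable def weyl (v : PhaseSpace n) : GL (Config n) ℂ :=
  tensor n fun i => localWeyl (n i) (v i)

/-- The diagonal part of the Weyl operator of `v`, a character of the configuration space. -/
noncomputable def phase (v : PhaseSpace n) (x : Config n) : ℂˣ :=
  ∏ i, rootChar (n i) (v i 0 * x i)

theorem phase_add (u v : PhaseSpace n) (x : Config n) : phase (u + v) x = phase u x * phase v x := by
  simp [phase, add_mul, AddChar.map_add_eq_mul, Finset.prod_mul_distrib]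

theorem phase_inc (i : Fin k) (t : ZMod (n i)) (x : Config n) :
    phase (inc i 0 t) x = rootChar (n i) (t * x i) := by
  rw [phase, Finset.prod_eq_single i]
  · simp [inc_same]
  · intro j _ hj
    simp [inc_ne hj]
  · simp

theorem weyl_apply (v : PhaseSpace n) (x y : Config n) : (weyl v).val x y =
    if (y = fun i => x i + v i 1) then (phase v x : ℂ) else 0 := by
  change ∏ i, (localWeyl (n i) (v i)).val (x i) (y i) = _
  simp only [localWeyl_apply, funext_iff, phase, Units.coe_prod]
  rw [Finset.prod_ite_zero]
  simp

theorem weyl_mul (u v : PhaseSpace n) : weyl u * weyl v =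
    (∏ i, rootChar (n i) (v i 0 * u i 1)) • weyl (u + v) := by
  rw [weyl, weyl, ← map_mul, weyl, ← tensor_smul]
  congr 1
  ext1 i
  exact localWeyl_mul _ _

/-- The commutation relation of the Weyl operators. -/
theorem weyl_comm (u v : PhaseSpace n) : weyl v * weyl u = form u v • (weyl u * weyl v) := by
  rw [weyl_mul, weyl_mul, add_comm v u, smul_smul]
  congr 1
  rw [form, ← Finset.prod_mul_distrib]
  refine Finset.prod_congr rfl fun i _ => ?_
  rw [← AddChar.map_add_eq_mul]
  congr 1
  ring

/-- The element `Ad_{W(v)}` of the Pauli group, for a vector `v` of the phase space. -/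
noncomputable def pauli (v : PhaseSpace n) : InnGL (Config n) := Ad (weyl v)

theorem pauli_add (u v : PhaseSpace n) : pauli (u + v) = pauli u * pauli v := by
  rw [pauli, pauli, pauli, ← map_mul, weyl_mul, Ad_smul]

theorem pauli_injective : Function.Injective (pauli (n := n)) := by
  intro u v h
  obtain ⟨c, hc⟩ := (Ad_eq_iff _ _).1 h
  refine eq_of_form_eq fun w => ?_
  have h1 := weyl_comm w u
  rw [hc, smul_mul_assoc, mul_smul_comm, smul_comm _ c, weyl_comm w v] at h1
  exact (smul_GL_cancel (smul_left_cancel c h1)).symm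

theorem exists_pauli_of_local (X : ∀ i, GL (ZMod (n i)) ℂ) (hX : ∀ i, Ad (X i) ∈ pauliAd (n i)) :
    ∃ v, Ad (tensor n X) = pauli v := by
  choose v hv using fun i => (mem_pauliAd_iff _).1 (hX i)
  choose c hc using fun i => (Ad_eq_iff _ _).1 (hv i)
  refine ⟨v, ?_⟩
  rw [show X = fun i => c i • localWeyl (n i) (v i) from funext hc, tensor_smul, Ad_smul]
  rfl

theorem mem_pauliAdTensor_iff (φ : InnGL (Config n)) :
    φ ∈ pauliAdTensor n ↔ ∃ v, φ = pauli v := by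
  constructor
  · rintro ⟨_, ⟨X, hX, rfl⟩, rfl⟩
    refine exists_pauli_of_local X fun i => ?_
    rw [← heisenberg_map_Ad]
    exact ⟨X i, hX i trivial, rfl⟩
  · rintro ⟨v, rfl⟩
    have h : ∀ i, ∃ X ∈ heisenberg (n i), Ad X = Ad (localWeyl (n i) (v i)) := fun i => by
      have : Ad (localWeyl (n i) (v i)) ∈ pauliAd (n i) := (mem_pauliAd_iff _).2 ⟨_, rfl⟩
      rwa [← heisenberg_map_Ad] at this
    choose X hX hXv using h
    choose c hc using fun i => (Ad_eq_iff _ _).1 (hXv i)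
    refine ⟨tensor n X, ⟨X, fun i _ => hX i, rfl⟩, ?_⟩
    rw [show X = fun i => c i • localWeyl (n i) (v i) from funext hc, tensor_smul, Ad_smul]
    rfl

instance : Finite (pauliAdTensor n : Set (InnGL (Config n))) :=
  (Set.finite_range (pauli (n := n))).subset fun φ h => by
    obtain ⟨v, rfl⟩ := (mem_pauliAdTensor_iff φ).1 h
    exact ⟨v, rfl⟩

theorem mem_normalizer_of_conj {φ : InnGL (Config n)} {g : PhaseSpace n → PhaseSpace n}
    (h : ∀ v, φ * pauli v * φ⁻¹ = pauli (g v)) :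
    φ ∈ Subgroup.normalizer (pauliAdTensor n : Set (InnGL (Config n))) := by
  refine Subgroup.mem_normalizer_fintype fun ψ hψ => ?_
  obtain ⟨v, rfl⟩ := (mem_pauliAdTensor_iff ψ).1 hψ
  exact (mem_pauliAdTensor_iff _).2 ⟨_, h v⟩

/-- An element of the normalizer permutes the Pauli group through an isometry of the phase space,
because conjugation preserves the commutation relation of the Weyl operators. -/
theorem exists_isometry {φ : InnGL (Config n)}
    (hφ : φ ∈ Subgroup.normalizer (pauliAdTensor n : Set (InnGL (Config n)))) :
    ∃ g : isometries n, ∀ v, pauli (g.1 v) = φ * pauli v * φ⁻¹ := by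
  have h : ∀ v, ∃ w, φ * pauli v * φ⁻¹ = pauli w := fun v =>
    (mem_pauliAdTensor_iff _).1
      ((Subgroup.mem_normalizer_iff.1 hφ _).1 ((mem_pauliAdTensor_iff _).2 ⟨v, rfl⟩))
  choose g hg using h
  have hadd : ∀ u v, g (u + v) = g u + g v := fun u v => by
    apply pauli_injective
    rw [pauli_add, ← hg, ← hg, ← hg, pauli_add]
    group
  obtain ⟨X, rfl⟩ := Ad_surjective φ
  have hc : ∀ v, ∃ c : ℂˣ, X * weyl v * X⁻¹ = c • weyl (g v) := fun v => by
    rw [← Ad_eq_iff, map_mul, map_mul, map_inv]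
    exact hg v
  choose c hc using hc
  have hform : ∀ u v, form (g u) (g v) = form u v := fun u v => by
    have h1 : (X * weyl v * X⁻¹) * (X * weyl u * X⁻¹) =
        form u v • ((X * weyl u * X⁻¹) * (X * weyl v * X⁻¹)) := by
      have := congrArg (fun Y => X * Y * X⁻¹) (weyl_comm u v)
      rw [mul_smul_comm, smul_mul_assoc] at this
      simpa [mul_assoc] using this
    rw [hc, hc, smul_mul_smul_comm, smul_mul_smul_comm, weyl_comm (g u) (g v), smul_smul,
      smul_smul, mul_comm (c v)] at h1
    have h2 := smul_GL_cancel h1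
    rw [mul_comm (form u v)] at h2
    exact mul_left_cancel h2
  exact ⟨⟨AddMonoidHom.mk' g hadd, hform⟩, fun v => (hg v).symm⟩

/-- The Weyl operators act irreducibly. -/
theorem exists_eq_smul_one_of_commute (X : GL (Config n) ℂ)
    (h : ∀ v, X * weyl v = weyl v * X) : ∃ c : ℂˣ, X = c • (1 : GL (Config n) ℂ) := by
  have hent : ∀ v x z, (X * weyl v).val x z = (weyl v * X).val x z := fun v x z => by rw [h]
  -- entries of the two products for a Weyl operator with exponents `(a, b)`
  have key : ∀ (v : PhaseSpace n) (x y : Config n),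
      X.val x y * phase v y =
        phase v x * X.val (fun i => x i + v i 1) fun i => y i + v i 1 := fun v x y => by
    have h1 := hent v x fun i => y i + v i 1
    rw [Units.val_mul, Units.val_mul, Matrix.mul_apply, Matrix.mul_apply,
      Finset.sum_eq_single y, Finset.sum_eq_single fun i => x i + v i 1] at h1
    · simpa [weyl_apply] using h1
    · intro z _ hz
      simp [weyl_apply, hz]
    · simp
    · intro z _ hz
      have : ¬ (fun i => y i + v i 1) = fun i => z i + v i 1 := fun h => hz <| by
        ext i
        exact (add_right_cancel (congrFun h i)).symm
      simp [weyl_apply, this]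
    · simp
  have hdiag : ∀ x y, x ≠ y → X.val x y = 0 := by
    intro x y hxy
    obtain ⟨i, hi⟩ := Function.ne_iff.1 hxy
    have h1 := key (inc i 0 1) x y
    have hz : ∀ j, (inc i 0 1 : PhaseSpace n) j 1 = 0 := fun j => by
      rcases eq_or_ne j i with rfl | hj
      · simp [inc_same]
      · simp [inc_ne hj]
    simp only [phase_inc, hz, add_zero, one_mul] at h1
    by_contra hne
    rw [mul_comm] at h1
    exact hi (rootChar_injective _ (Units.ext (mul_right_cancel₀ hne h1))).symm
  have hconst : ∀ x, X.val x x = X.val 0 0 := fun x => by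
    have h1 := key (fun i => ![0, x i]) 0 0
    simpa [phase] using h1.symm
  have hX : X.val = Matrix.scalar (Config n) (X.val 0 0) := by
    ext x y
    rcases eq_or_ne x y with rfl | hxy
    · simp [hconst]
    · simp [hxy, hdiag x y hxy]
  have hne : X.val 0 0 ≠ 0 := fun h0 => by
    rw [h0, map_zero] at hX
    exact X.ne_zero hX
  refine ⟨Units.mk0 _ hne, Units.ext (hX.trans ?_)⟩
  ext x y
  simp [Matrix.one_apply, Matrix.diagonal_apply, Units.smul_def]

/-- The form identifies the phase space with its group of characters. -/
theorem exists_form_eq (c : PhaseSpace n → ℂˣ) (hc : ∀ u v, c (u + v) = c u * c v) :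
    ∃ w, ∀ v, c v = form w v := by
  have hcn : ∀ (m : ℕ) v, c (m • v) = c v ^ m := fun m v => by
    induction m with
    | zero => simpa using hc 0 0
    | succ m ih => rw [succ_nsmul, hc, ih, pow_succ]
  have hroot : ∀ i b, ∃ t : ZMod (n i), c (inc i b 1) = rootChar (n i) t := fun i b => by
    have h1 : ((c (inc i b 1) : ℂˣ) : ℂ) ^ n i = 1 := by
      rw [← Units.val_pow_eq_pow_val, ← hcn, nsmul_inc]
      have h0 : c 0 = 1 := by simpa using hc 0 0
      rw [h0, Units.val_one]
    obtain ⟨m, -, hm⟩ := (Complex.isPrimitiveRoot_exp (n i) (NeZero.ne _)).eq_pow_of_pow_eq_one h1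
    refine ⟨m, Units.ext ?_⟩
    rw [← hm, rootChar, AddChar.zmodChar_apply', Units.val_pow_eq_pow_val]
    rfl
  choose t ht using hroot
  refine ⟨fun i => ![t i 1, -t i 0], fun v => ?_⟩
  let C : PhaseSpace n →+ Additive ℂˣ := AddMonoidHom.mk' (fun v => Additive.ofMul (c v)) hc
  let F : PhaseSpace n →+ Additive ℂˣ := AddMonoidHom.mk'
    (fun v => Additive.ofMul (form (fun i => ![t i 1, -t i 0]) v)) fun u v => by
      rw [form_swap, form_add_left, mul_inv, ← form_swap, ← form_swap, ofMul_mul]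
  have hCF : ∀ l : Fin k → Fin 2 → ℤ, C (red n l) = F (red n l) := fun l => by
    rw [← sum_inc (red n l)]
    simp only [map_sum, red, inc_intCast, map_zsmul]
    refine Finset.sum_congr rfl fun i _ => Finset.sum_congr rfl fun b _ => congrArg _ ?_
    change c (inc i b 1) = form _ _
    rw [ht, form_swap]
    fin_cases b
    · change rootChar (n i) (t i 0) = (form (inc i 0 1) _)⁻¹
      rw [form_inc_zero, ← AddChar.map_neg_eq_inv]
      simp
    · change rootChar (n i) (t i 1) = (form (inc i 1 1) _)⁻¹
      rw [form_inc_one, ← AddChar.map_neg_eq_inv]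
      simp
  obtain ⟨l, rfl⟩ := red_surjective v
  exact hCF l

/-- The centralizer of the Pauli group is the Pauli group: if `X` commutes with the Weyl operators
up to scalars, these scalars form a character, which also arises from some Weyl operator `W`, and
then `X W` commutes with all Weyl operators. -/
theorem mem_pauliAdTensor_of_commute {φ : InnGL (Config n)}
    (h : ∀ v, φ * pauli v * φ⁻¹ = pauli v) : φ ∈ pauliAdTensor n := by
  obtain ⟨X, rfl⟩ := Ad_surjective φ
  have hc : ∀ v, ∃ c : ℂˣ, X * weyl v * X⁻¹ = c • weyl v := fun v => by
    rw [← Ad_eq_iff, map_mul, map_mul, map_inv]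
    exact h v
  choose c hc using hc
  have hadd : ∀ u v, c (u + v) = c u * c v := fun u v => by
    have h1 : X * (weyl u * weyl v) * X⁻¹ = (X * weyl u * X⁻¹) * (X * weyl v * X⁻¹) := by group
    rw [hc, hc, smul_mul_smul_comm, weyl_mul, mul_smul_comm, smul_mul_assoc, hc,
      smul_comm (c u * c v)] at h1
    exact smul_GL_cancel (smul_left_cancel _ h1)
  obtain ⟨w, hw⟩ := exists_form_eq c hadd
  have hcomm : ∀ v, X * weyl w * weyl v = weyl v * (X * weyl w) := fun v => by
    have hXv : X * weyl v = c v • (weyl v * X) := by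
      rw [← smul_mul_assoc, ← hc, inv_mul_cancel_right]
    refine smul_left_cancel (form w v) ?_
    rw [mul_assoc, ← mul_smul_comm, ← weyl_comm, ← mul_assoc, hXv, hw, smul_mul_assoc, mul_assoc]
  obtain ⟨d, hd⟩ := exists_eq_smul_one_of_commute _ hcomm
  have h1 : Ad X * pauli w = 1 := by
    rw [pauli, ← map_mul, hd, Ad_smul, map_one]
  rw [eq_inv_of_mul_eq_one_left h1]
  exact inv_mem ((mem_pauliAdTensor_iff _).2 ⟨w, rfl⟩)

end Weyl

/-! ### Matrices inducing the elementary isometries -/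

section Gates

section Local

variable {n : ℕ} [NeZero n]

theorem diagGL_apply {ι : Type} [Fintype ι] [DecidableEq ι] (c : ι → ℂˣ) (x y : ι) :
    (diagGL c).val x y = if x = y then (c x : ℂ) else 0 :=
  Matrix.diagonal_apply _ _ _

theorem sum_rootChar (b : ZMod n) :
    ∑ x : ZMod n, (rootChar n (x * b) : ℂ) = if b = 0 then (n : ℂ) else 0 := by
  have hprim : IsPrimitiveRoot (omega n : ℂ) n := Complex.isPrimitiveRoot_exp n (NeZero.ne n)
  have h := AddChar.sum_mulShift b (AddChar.zmodChar_primitive_of_primitive_root n hprim)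
  rw [ZMod.card] at h
  refine Eq.trans ?_ (h.trans (by split_ifs <;> simp))
  refine Finset.sum_congr rfl fun x _ => ?_
  rw [rootChar, AddChar.zmodChar_apply, AddChar.zmodChar_apply, Units.val_pow_eq_pow_val]

variable (n) in
/-- The matrix `(ω_n ^ (x y))` of the discrete Fourier transform. -/
noncomputable def fourierGL : GL (ZMod n) ℂ where
  val := Matrix.of fun x y => (rootChar n (x * y) : ℂ)
  inv := Matrix.of fun x y => (n : ℂ)⁻¹ * (rootChar n (-(x * y)) : ℂ)
  val_inv := by
    have hn : (n : ℂ) ≠ 0 := by exact_mod_cast NeZero.ne n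
    ext x z
    have h : ∀ y, (rootChar n (x * y) : ℂ) * ((n : ℂ)⁻¹ * (rootChar n (-(y * z)) : ℂ)) =
        (n : ℂ)⁻¹ * (rootChar n (y * (x - z)) : ℂ) := fun y => by
      rw [mul_left_comm, ← Units.val_mul, ← AddChar.map_add_eq_mul]
      congr 3
      ring
    simp only [Matrix.mul_apply, Matrix.of_apply, h, ← Finset.mul_sum, sum_rootChar,
      Matrix.one_apply, sub_eq_zero]
    split_ifs <;> simp [hn]
  inv_val := by
    have hn : (n : ℂ) ≠ 0 := by exact_mod_cast NeZero.ne n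
    ext x z
    have h : ∀ y, (n : ℂ)⁻¹ * (rootChar n (-(x * y)) : ℂ) * (rootChar n (y * z) : ℂ) =
        (n : ℂ)⁻¹ * (rootChar n (y * (z - x)) : ℂ) := fun y => by
      rw [mul_assoc, ← Units.val_mul, ← AddChar.map_add_eq_mul]
      congr 3
      ring
    simp only [Matrix.mul_apply, Matrix.of_apply, h, ← Finset.mul_sum, sum_rootChar,
      Matrix.one_apply, sub_eq_zero, eq_comm (a := z)]
    split_ifs <;> simp [hn]

theorem fourierGL_mul_localWeyl (v : Fin 2 → ZMod n) : fourierGL n * localWeyl n v =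
    rootChar n (-(v 0 * v 1)) • (localWeyl n ![-v 1, v 0] * fourierGL n) := by
  ext x z
  rw [Units.val_mul, Units.val_smul, Units.val_mul, Matrix.smul_apply, Matrix.mul_apply,
    Matrix.mul_apply, Finset.sum_eq_single (z - v 1), Finset.sum_eq_single (x + v 0)]
  · simp only [localWeyl_apply, fourierGL, Matrix.of_apply, sub_add_cancel, if_true,
      Units.smul_def, smul_eq_mul, Matrix.cons_val_one, Matrix.cons_val_zero, ← Units.val_mul,
      ← AddChar.map_add_eq_mul]
    congr 2
    ring
  · intro y _ hy
    simp [localWeyl_apply, hy]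
  · simp
  · intro y _ hy
    have : z ≠ y + v 1 := fun h => hy (eq_sub_of_add_eq h.symm)
    simp [localWeyl_apply, this]
  · simp

/-- The character value `exp (-π i x (x + n) / n)` at representatives `x`. The summand `n` makes
it well defined on `ℤ/n` also for even `n`. -/
noncomputable def gauss (n : ℕ) (x : ZMod n) : ℂˣ :=
  ratChar (-(x.val * (x.val + n)) / (2 * n) : ℚ)

theorem gauss_intCast (m : ℤ) : gauss n m = ratChar (-(m * (m + n)) / (2 * n) : ℚ) := by
  obtain ⟨t, ht⟩ : (n : ℤ) ∣ ((m : ZMod n).val : ℤ) - m := by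
    rw [← ZMod.intCast_eq_intCast_iff_dvd_sub]
    simp
  obtain ⟨s, hs⟩ : (2 : ℤ) ∣ t * (t + 1) := (Int.even_mul_succ_self t).two_dvd
  have hx : (((m : ZMod n).val : ℤ) : ℚ) = m + n * t := by
    rw [sub_eq_iff_eq_add'] at ht
    exact_mod_cast ht
  have hs' : (t : ℚ) * (t + 1) = 2 * s := by exact_mod_cast hs
  have hn : (n : ℚ) ≠ 0 := by exact_mod_cast NeZero.ne n
  rw [gauss, ratChar_eq_iff]
  refine ⟨-(m * t + n * s), ?_⟩
  rw [Int.cast_natCast] at hx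
  rw [hx, ← sub_div, div_eq_iff (by positivity)]
  push_cast
  linear_combination (-(n : ℚ) ^ 2) * hs'

theorem gauss_add (x b : ZMod n) :
    gauss n x = (gauss n b)⁻¹ * rootChar n (x * b) * gauss n (x + b) := by
  obtain ⟨x, rfl⟩ := ZMod.intCast_surjective x
  obtain ⟨b, rfl⟩ := ZMod.intCast_surjective b
  have hn : (n : ℚ) ≠ 0 := by exact_mod_cast NeZero.ne n
  rw [← Int.cast_add, ← Int.cast_mul, gauss_intCast, gauss_intCast, gauss_intCast,
    rootChar_intCast, ← AddChar.map_neg_eq_inv, ← AddChar.map_add_eq_mul, ← AddChar.map_add_eq_mul,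
    ratChar_eq_iff]
  refine ⟨0, ?_⟩
  push_cast
  field_simp
  ring

theorem gauss_mul_localWeyl (v : Fin 2 → ZMod n) : diagGL (gauss n) * localWeyl n v =
    (gauss n (v 1))⁻¹ • (localWeyl n ![v 0 + v 1, v 1] * diagGL (gauss n)) := by
  ext x z
  rw [Units.val_mul, Units.val_smul, Units.val_mul, Matrix.smul_apply, Matrix.mul_apply,
    Matrix.mul_apply, Finset.sum_eq_single x, Finset.sum_eq_single z]
  · have hw : (localWeyl n ![v 0 + v 1, v 1]).val x z =
        if z = x + v 1 then (rootChar n ((v 0 + v 1) * x) : ℂ) else 0 := localWeyl_apply _ _ _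
    simp only [hw, localWeyl_apply, diagGL_apply, if_true, Units.smul_def, smul_eq_mul, ite_mul,
      mul_ite, zero_mul, mul_zero]
    split_ifs with h
    · rw [h, ← Units.val_mul, ← Units.val_mul, ← Units.val_mul, gauss_add x (v 1), add_mul,
        AddChar.map_add_eq_mul, mul_comm (v 1)]
      congr 1
      simp only [mul_comm, mul_left_comm]
    · rfl
  · intro y _ hy
    simp [diagGL_apply, hy]
  · simp
  · intro y _ hy
    simp [diagGL_apply, Ne.symm hy]
  · simp

end Local

variable {k : ℕ} {n : Fin k → ℕ} [∀ i, NeZero (n i)]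

/-- An operator on the `i`-th factor that permutes the local Weyl operators up to scalars gives
an element of the local normalizer. -/
theorem exists_mem_localNormalizer (i : Fin k) (X : GL (ZMod (n i)) ℂ)
    (g : (Fin 2 → ZMod (n i)) → Fin 2 → ZMod (n i))
    (h : ∀ v, ∃ c : ℂˣ, X * localWeyl (n i) v = c • (localWeyl (n i) (g v) * X)) :
    ∃ φ ∈ localNormalizer n, ∀ v, φ * pauli v * φ⁻¹ = pauli (Function.update v i (g (v i))) := by
  let Y : ∀ j, GL (ZMod (n j)) ℂ := Function.update 1 i X
  have hconj : ∀ v, ∃ c : ℂˣ, X * localWeyl (n i) v * X⁻¹ = c • localWeyl (n i) (g v) := fun v => by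
    obtain ⟨c, hc⟩ := h v
    exact ⟨c, by rw [hc, smul_mul_assoc, mul_inv_cancel_right]⟩
  refine ⟨Ad (tensor n Y), ⟨Y, fun j => ?_, rfl⟩, fun v => ?_⟩
  · rcases eq_or_ne j i with rfl | hj
    · refine Subgroup.mem_normalizer_fintype fun ψ hψ => ?_
      obtain ⟨v, rfl⟩ := (mem_pauliAd_iff ψ).1 hψ
      obtain ⟨c, hc⟩ := hconj v
      refine (mem_pauliAd_iff _).2 ⟨g v, ?_⟩
      rw [show Y j = X from Function.update_self _ _ _, ← map_mul, ← map_inv, ← map_mul, hc, Ad_smul]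
    · rw [show Y j = 1 from Function.update_of_ne hj _ _, map_one]
      exact one_mem _
  · have hY : ∀ j, ∃ c : ℂˣ, Y j * localWeyl (n j) (v j) * (Y j)⁻¹ =
        c • localWeyl (n j) (Function.update v i (g (v i)) j) := fun j => by
      rcases eq_or_ne j i with rfl | hj
      · rw [show Y j = X from Function.update_self _ _ _, Function.update_self]
        exact hconj _
      · rw [show Y j = 1 from Function.update_of_ne hj _ _, Function.update_of_ne hj]
        exact ⟨1, by simp⟩
    choose c hc using hY
    rw [pauli, ← map_inv, ← map_mul, ← map_mul, weyl, ← map_inv, ← map_mul, ← map_mul,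
      show Y * (fun j => localWeyl (n j) (v j)) * Y⁻¹ =
        fun j => c j • localWeyl (n j) (Function.update v i (g (v i)) j) from funext hc,
      tensor_smul, Ad_smul]
    rfl

theorem rootChar_mul_mulRatio (i j : Fin k) (x : ZMod (n i)) (y : ZMod (n j)) :
    rootChar (n i) (x * mulRatio i j y) = rootChar (n j) (y * mulRatio j i x) := by
  obtain ⟨x, rfl⟩ := ZMod.intCast_surjective x
  obtain ⟨y, rfl⟩ := ZMod.intCast_surjective y
  have hi : (n i : ℚ) ≠ 0 := by exact_mod_cast NeZero.ne (n i)
  have hj : (n j : ℚ) ≠ 0 := by exact_mod_cast NeZero.ne (n j)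
  have hr : (n j : ℚ) * ratio n i j = n i * ratio n j i := by
    exact_mod_cast mul_ratio_comm n i j
  rw [mulRatio_intCast, mulRatio_intCast, ← Int.cast_mul, ← Int.cast_mul, rootChar_intCast,
    rootChar_intCast]
  congr 1
  rw [div_eq_div_iff hi hj]
  push_cast
  linear_combination (x * y : ℚ) * hr

/-- `R_{ij}` is the exponential of the bilinear pairing of the `i`-th and `j`-th coordinates with
values in the `gcd (n_i, n_j)`-th roots of unity. -/
theorem R_eq (i j : Fin k) :
    R n i j = diagGL fun x => rootChar (n i) (x i * mulRatio i j (x j)) := by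
  rw [R]
  congr 1
  ext1 x
  have hji : mulRatio j i (x i) = ((n j / Nat.gcd (n i) (n j) * (x i).val : ℕ) : ZMod (n j)) := by
    conv_lhs => rw [← ZMod.natCast_zmod_val (x i), ← Int.cast_natCast, mulRatio_intCast]
    rw [ratio, Nat.gcd_comm, ← Nat.cast_mul, Int.cast_natCast]
  rw [rootChar_mul_mulRatio, hji, mul_comm, ← nsmul_eq_mul, AddChar.map_nsmul_eq_pow, ← pow_mul,
    ← pow_mul, pow_mul]
  rfl

theorem weyl_mul_R (i j : Fin k) (v : PhaseSpace n) : weyl v * R n i j =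
    rootChar (n i) (v i 1 * mulRatio i j (v j 1)) •
      (R n i j *
        weyl (v + (inc i 0 (mulRatio i j (v j 1)) + inc j 0 (mulRatio j i (v i 1))))) := by
  have hP : ∀ l, (v + (inc i 0 (mulRatio i j (v j 1)) + inc j 0 (mulRatio j i (v i 1)))) l 1 =
      v l 1 := fun l => by
    have h0 : ∀ (m : Fin k) (t : ZMod (n m)), (inc m 0 t : PhaseSpace n) l 1 = 0 := fun m t => by
      rcases eq_or_ne l m with rfl | h
      · simp [inc_same]
      · simp [inc_ne h]
    rw [Pi.add_apply, Pi.add_apply, Pi.add_apply, Pi.add_apply, h0, h0, add_zero, add_zero]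
  rw [R_eq]
  ext x z
  rw [Units.val_mul, Units.val_smul, Units.val_mul, Matrix.smul_apply, Matrix.mul_apply,
    Matrix.mul_apply, Finset.sum_eq_single z, Finset.sum_eq_single x]
  · simp only [weyl_apply, hP, diagGL_apply, if_true, Units.smul_def, smul_eq_mul, ite_mul, mul_ite,
      zero_mul, mul_zero]
    split_ifs with h
    · subst h
      rw [phase_add, phase_add, phase_inc, phase_inc, ← Units.val_mul, ← Units.val_mul,
        ← Units.val_mul, mul_comm (mulRatio j i (v i 1)), ← rootChar_mul_mulRatio i j (v i 1) (x j),
        mul_comm (mulRatio i j (v j 1)), map_add, add_mul, mul_add, mul_add,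
        AddChar.map_add_eq_mul, AddChar.map_add_eq_mul, AddChar.map_add_eq_mul]
      congr 1
      simp only [mul_comm, mul_left_comm, mul_assoc]
    · rfl
  · intro y _ hy
    simp [diagGL_apply, Ne.symm hy]
  · simp
  · intro y _ hy
    simp [diagGL_apply, hy]
  · simp

theorem conj_R_inv (i j : Fin k) (v : PhaseSpace n) : (Ad (R n i j))⁻¹ * pauli v * (Ad (R n i j)) =
    pauli (v + (inc i 0 (mulRatio i j (v j 1)) + inc j 0 (mulRatio j i (v i 1)))) := by
  rw [mul_assoc, inv_mul_eq_iff_eq_mul, pauli, ← map_mul, weyl_mul_R, Ad_smul, map_mul]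
  rfl

theorem R_comm (i j : Fin k) : R n i j = R n j i := by
  rw [R_eq, R_eq]
  congr 1
  ext1 x
  exact rootChar_mul_mulRatio i j (x i) (x j)

end Gates

/-! ### The normalizer of the Pauli group -/

section Normalizer

variable {k : ℕ} (n : Fin k → ℕ) [∀ i, NeZero (n i)]

/-- The normalizer of the Pauli group. -/
abbrev clifford : Subgroup (InnGL (Config n)) :=
  Subgroup.normalizer (pauliAdTensor n : Set (InnGL (Config n)))

/-- The group generated by the local normalizers and the elements `Ad_{R_{ij}}`. -/
def generated : Subgroup (InnGL (Config n)) :=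
  Subgroup.closure (localNormalizer n ∪ {φ | ∃ i j : Fin k, i < j ∧ φ = Ad (R n i j)})

variable {n}

theorem generated_le_clifford : generated n ≤ clifford n := by
  rw [generated, Subgroup.closure_le]
  rintro φ (⟨X, hX, rfl⟩ | ⟨i, j, -, rfl⟩)
  · refine Subgroup.mem_normalizer_fintype fun ψ hψ => ?_
    obtain ⟨v, rfl⟩ := (mem_pauliAdTensor_iff ψ).1 hψ
    rw [pauli, ← map_inv, ← map_mul, ← map_mul, weyl, ← map_inv, ← map_mul, ← map_mul]
    refine (mem_pauliAdTensor_iff _).2 (exists_pauli_of_local _ fun i => ?_)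
    have := (Subgroup.mem_normalizer_iff.1 (hX i) _).1 ((mem_pauliAd_iff _).2 ⟨v i, rfl⟩)
    rw [← map_inv, ← map_mul, ← map_mul] at this
    exact this
  · rw [← inv_inv (Ad (R n i j))]
    refine inv_mem (mem_normalizer_of_conj (g := fun v =>
      v + (inc i 0 (mulRatio i j (v j 1)) + inc j 0 (mulRatio j i (v i 1)))) fun v => ?_)
    rw [inv_inv, conj_R_inv]

/-- The isometry of the phase space induced by an element of the normalizer. -/
noncomputable def toIsometry : clifford n →* isometries n where
  toFun φ := (exists_isometry φ.2).choose
  map_one' := by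
    refine Subtype.ext (DFunLike.ext _ _ fun v => pauli_injective ?_)
    rw [(exists_isometry (1 : clifford n).2).choose_spec]
    simp
  map_mul' φ ψ := by
    refine Subtype.ext (DFunLike.ext _ _ fun v => pauli_injective ?_)
    rw [(exists_isometry (φ * ψ).2).choose_spec]
    change _ = pauli ((exists_isometry φ.2).choose.1 ((exists_isometry ψ.2).choose.1 v))
    rw [(exists_isometry φ.2).choose_spec, (exists_isometry ψ.2).choose_spec]
    push_cast
    group

theorem pauli_toIsometry (φ : clifford n) (v : PhaseSpace n) :
    pauli ((toIsometry φ).1 v) = φ * pauli v * (φ : InnGL (Config n))⁻¹ :=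
  (exists_isometry φ.2).choose_spec v

theorem toIsometry_eq_one_iff (φ : clifford n) :
    toIsometry φ = 1 ↔ (φ : InnGL (Config n)) ∈ pauliAdTensor n := by
  constructor
  · intro h
    refine mem_pauliAdTensor_of_commute fun v => ?_
    rw [← pauli_toIsometry, h]
    rfl
  · intro h
    obtain ⟨w, hw⟩ := (mem_pauliAdTensor_iff _).1 h
    refine Subtype.ext (DFunLike.ext _ _ fun v => pauli_injective ?_)
    rw [pauli_toIsometry, hw, ← pauli_add, add_comm, pauli_add, mul_inv_cancel_right]
    rfl

/-- The isometries of the phase space that are induced by the generated subgroup. -/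
noncomputable def generatedIsometries (n : Fin k → ℕ) [∀ i, NeZero (n i)] :
    Submonoid (AddMonoid.End (PhaseSpace n)) :=
  ((generated n).subgroupOf (clifford n)).toSubmonoid.map
    ((isometries n).subtype.comp toIsometry)

theorem mem_generatedIsometries {φ : InnGL (Config n)} (hφ : φ ∈ generated n)
    {g : PhaseSpace n → PhaseSpace n} (hg : ∀ v, φ * pauli v * φ⁻¹ = pauli (g v)) :
    ∃ f ∈ generatedIsometries n, ∀ v, f v = g v :=
  ⟨_, ⟨⟨φ, generated_le_clifford hφ⟩, hφ, rfl⟩, fun v => pauli_injective <|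
    (pauli_toIsometry ⟨φ, generated_le_clifford hφ⟩ v).trans (hg v)⟩

theorem isElementary_generatedIsometries : IsElementary (generatedIsometries n) where
  isometry := by
    rintro _ ⟨φ, -, rfl⟩
    exact (toIsometry φ).2
  inv := by
    rintro _ ⟨φ, hφ, rfl⟩
    refine ⟨_, ⟨φ⁻¹, ((generated n).subgroupOf (clifford n)).inv_mem hφ, rfl⟩, ?_⟩
    rw [← map_mul, inv_mul_cancel, map_one]
  shear i := by
    obtain ⟨φ, hφ, h⟩ := exists_mem_localNormalizer i (diagGL (gauss (n i)))
      (fun v => ![v 0 + v 1, v 1]) fun v => ⟨_, gauss_mul_localWeyl v⟩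
    obtain ⟨f, hf, hfv⟩ := mem_generatedIsometries (Subgroup.subset_closure (Or.inl hφ)) h
    refine ⟨f, hf, fun v => (hfv v).trans ?_⟩
    ext j b
    rcases eq_or_ne j i with rfl | hj
    · fin_cases b <;> simp [inc_same]
    · simp [inc_ne hj, Function.update_of_ne hj]
  rot i := by
    obtain ⟨φ, hφ, h⟩ := exists_mem_localNormalizer i (fourierGL (n i))
      (fun v => ![-v 1, v 0]) fun v => ⟨_, fourierGL_mul_localWeyl v⟩
    exact mem_generatedIsometries (Subgroup.subset_closure (Or.inl hφ)) h
  couple i j hij := by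
    have hR : Ad (R n i j) ∈ generated n := by
      rcases lt_or_gt_of_ne hij with h | h
      · exact Subgroup.subset_closure (Or.inr ⟨i, j, h, rfl⟩)
      · rw [R_comm]
        exact Subgroup.subset_closure (Or.inr ⟨j, i, h, rfl⟩)
    refine mem_generatedIsometries (inv_mem hR) fun v => ?_
    rw [inv_inv, conj_R_inv]

/-- Every isometry is induced by an element of the generated subgroup. -/
theorem exists_mem_generated (g : isometries n) :
    ∃ φ : clifford n, (φ : InnGL (Config n)) ∈ generated n ∧ toIsometry φ = g := by
  obtain ⟨φ, hφ, h⟩ := isElementary_generatedIsometries.isometries_le g.2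
  exact ⟨φ, hφ, Subtype.ext h⟩

theorem pauliAdTensor_le_generated : pauliAdTensor n ≤ generated n := by
  rintro _ ⟨_, ⟨X, hX, rfl⟩, rfl⟩
  refine Subgroup.subset_closure (Or.inl ⟨X, fun i => Subgroup.le_normalizer ?_, rfl⟩)
  rw [← heisenberg_map_Ad]
  exact ⟨X i, hX i trivial, rfl⟩

theorem clifford_eq_generated : clifford n = generated n := by
  refine le_antisymm (fun φ hφ => ?_) generated_le_clifford
  obtain ⟨ψ, hψ, h⟩ := exists_mem_generated (toIsometry ⟨φ, hφ⟩)
  have h1 : toIsometry (⟨φ, hφ⟩ * ψ⁻¹) = 1 := by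
    rw [map_mul, ← h, ← map_mul, mul_inv_cancel, map_one]
  have h2 := pauliAdTensor_le_generated ((toIsometry_eq_one_iff _).1 h1)
  rw [← inv_mul_cancel_right φ (ψ : InnGL (Config n))]
  simpa using mul_mem h2 hψ

theorem nonempty_quotient_mulEquiv_Sp :
    Nonempty ((clifford n ⧸ (pauliAdTensor n).subgroupOf (clifford n)) ≃* Sp n) := by
  let f : clifford n →* Sp n := isometriesToSp.comp toIsometry
  have hf : ∀ φ, f φ = 1 ↔ φ ∈ (pauliAdTensor n).subgroupOf (clifford n) := fun φ => by
    rw [Subgroup.mem_subgroupOf, ← toIsometry_eq_one_iff]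
    exact map_eq_one_iff isometriesToSp isometriesToSp_bijective.1
  let F := QuotientGroup.lift ((pauliAdTensor n).subgroupOf (clifford n)) f fun φ hφ => (hf φ).2 hφ
  refine ⟨{ toEquiv := Equiv.ofBijective F ⟨?_, ?_⟩, map_mul' := F.map_mul }⟩
  · refine (MonoidHom.ker_eq_bot_iff F).1 ((Subgroup.eq_bot_iff_forall _).2 fun q hq => ?_)
    induction q using QuotientGroup.induction_on with | H φ =>
    exact (QuotientGroup.eq_one_iff φ).2 ((hf φ).1 hq)
  · refine QuotientGroup.lift_surjective_of_surjective _ _ ?_ _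
    intro H
    obtain ⟨g, rfl⟩ := isometriesToSp_bijective.2 H
    obtain ⟨φ, -, rfl⟩ := exists_mem_generated g
    exact ⟨φ, rfl⟩

end Normalizer

end MultipartiteHeisenberg

theorem theorem37 {k : ℕ} (n : Fin k → ℕ) [∀ i, NeZero (n i)] :
    Nonempty
      ((Subgroup.normalizer (MultipartiteHeisenberg.pauliAdTensor n :
            Set (MultipartiteHeisenberg.InnGL (MultipartiteHeisenberg.Config n))) ⧸
          (MultipartiteHeisenberg.pauliAdTensor n).subgroupOf
            (Subgroup.normalizer (MultipartiteHeisenberg.pauliAdTensor n :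
              Set (MultipartiteHeisenberg.InnGL (MultipartiteHeisenberg.Config n))))) ≃*
        MultipartiteHeisenberg.Sp n) ∧
    Subgroup.normalizer (MultipartiteHeisenberg.pauliAdTensor n :
        Set (MultipartiteHeisenberg.InnGL (MultipartiteHeisenberg.Config n))) =
      Subgroup.closure (MultipartiteHeisenberg.localNormalizer n ∪
        {φ | ∃ i j : Fin k, i < j ∧
          φ = MultipartiteHeisenberg.Ad (MultipartiteHeisenberg.R n i j)}) :=
  ⟨MultipartiteHeisenberg.nonempty_quotient_mulEquiv_Sp,
    MultipartiteHeisenberg.clifford_eq_generated⟩
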